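/- Let the coordinates of $x\in\mathbb{R}^n$ be partitioned into $K$ blocks, $x=(x_1,\dots,x_K)$, and let $F=f_1+f_2$ be one of the following functions on $\mathbb{R}^n$. (i) LASSO: $f_2(x)=\frac12\|Ax-b\|^2$ and $f_1(x)=\lambda\|x\|_1$, where $A\in\mathbb{R}^{m\times n}$, $b\in\mathbb{R}^m$ and $\lambda\ge 0$. (ii) Group LASSO: $f_2(x)=\frac12\|Ax-b\|^2$ and $f_1(x)=\sum_{J\in\mathcal J}w_J\|x_J\|$, where $\mathcal J$ is a partition of $\{1,\dots,n\}$ such that each $J\in\mathcal J$ is contained in a single block (for example, the blocks are the sets $J$), $w_J\ge 0$ for all $J$, and $\|\cdot\|$ is the Euclidean norm. (iii) Logistic Group LASSO: $f_2(x)=\sum_{i=1}^m\big(\log(1+\exp(a_i^Tx))-b_i\,a_i^Tx\big)$ with $a_i\in\mathbb{R}^n$ and $b_i\in\{0,1\}$, and $f_1$, $\mathcal J$, $w_J$ as in (ii). If some $w_J$ is zero, assume in addition that $F$ attains its minimum. Let $X^*$ be the set of minimizers of $F$ over $\mathbb{R}^n$. Say that $f_2$ is block coordinate-wise strongly convex on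 a set $S\subseteq\mathbb{R}^n$ if there is $\gamma>0$ such that $$f_2(x+\Delta)-f_2(x)-\langle\nabla f_2(x),\Delta\rangle\ \ge\ \gamma\|\Delta\|^2$$ whenever $x,\,x+\Delta\in S$ and $\Delta$ vanishes outside a single block. Assume that $f_2$ is block coordinate-wise strongly convex on $\mathbb{R}^n$ in cases (i) and (ii), and on every bounded subset of $\mathbb{R}^n$ (with $\gamma$ allowed to depend on the subset) in case (iii). No strong convexity jointly in all blocks is assumed. Consider the block coordinate descent (BCD) algorithm: in the step from $x^r$ to $x^{r+1}$ a block $s=s(r)$ is chosen, $x^{r+1}_s$ minimizes $F(x^r_1,\dots,x^r_{s-1},\,\cdot\,,x^r_{s+1},\dots,x^r_K)$, and $x^{r+1}_j=x^r_j$ for $j\ne s$. The blocks are chosen either cyclically, in the order $1,2,\dots,K,1,2,\dots$, or essentially cyclically, meaning that there is an integer $N\ge K$ such that every block is chosen at least once in any $N$ consecutive steps. Then, for every such choice of blocks and every starting point $x^0\in\mathbb{R}^n$, the BCD algorithm generates a unique sequence $(x^r)_{r\ge 0}$, and this sequence converges R-linearly to an optimal solution: there are $x^*\in X^*$, $C\ge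 0$ and $q\in(0,1)$ with $\|x^r-x^*\|\le Cq^r$ for all $r\ge 0$. -/

import Mathlib

noncomputable section

/-- The least squares loss `½ ‖A x - b‖²`. -/
def leastSquaresLoss {m n : ℕ} (A : Matrix (Fin m) (Fin n) ℝ) (b : EuclideanSpace ℝ (Fin m))
    (x : EuclideanSpace ℝ (Fin n)) : ℝ :=
  1 / 2 * ‖WithLp.toLp 2 (A.mulVec x.ofLp) - b‖ ^ 2

/-- The logistic loss `∑ i, (log (1 + exp (aᵢᵀ x)) - bᵢ aᵢᵀ x)`. -/
def logisticLoss {m n : ℕ} (a : Fin m → EuclideanSpace ℝ (Fin n)) (b : Fin m → ℝ)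
    (x : EuclideanSpace ℝ (Fin n)) : ℝ :=
  ∑ i, (Real.log (1 + Real.exp (inner ℝ (a i) x)) - b i * inner ℝ (a i) x)

/-- The regularizer `lam ‖x‖₁`. -/
def l1Penalty {n : ℕ} (lam : ℝ) (x : EuclideanSpace ℝ (Fin n)) : ℝ :=
  lam * ∑ i, |x i|

/-- The subvector `x_J` of the coordinates with label `J`, where a partition of the coordinates
is given by a labelling `c`. -/
def subvector {n p : ℕ} (c : Fin n → Fin p) (J : Fin p) (x : EuclideanSpace ℝ (Fin n)) :
    EuclideanSpace ℝ {i : Fin n // c i = J} :=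
  WithLp.toLp 2 (fun i => x i.1)

/-- The regularizer `∑_J w_J ‖x_J‖` with Euclidean norms of the subvectors. -/
def groupPenalty {n p : ℕ} (g : Fin n → Fin p) (w : Fin p → ℝ)
    (x : EuclideanSpace ℝ (Fin n)) : ℝ :=
  ∑ J, w J * ‖subvector g J x‖

/-- The set `X*` of minimizers of `F` over `ℝⁿ`. -/
def optimalSet {n : ℕ} (F : EuclideanSpace ℝ (Fin n) → ℝ) : Set (EuclideanSpace ℝ (Fin n)) :=
  {x | ∀ y, F x ≤ F y}

/-- Block coordinate-wise strong convexity of a differentiable `f` on `S`, with one modulus `γ > 0`: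
for `x` and `x + Δ` in `S`, with `Δ` supported in a single block,
`f (x + Δ) - f x - ⟨∇f x, Δ⟩ ≥ γ ‖Δ‖²`. The blocks are the fibres of `blk`. -/
def BlockStronglyConvexOn {n K : ℕ} (blk : Fin n → Fin K) (f : EuclideanSpace ℝ (Fin n) → ℝ)
    (S : Set (EuclideanSpace ℝ (Fin n))) : Prop :=
  ∃ γ : ℝ, 0 < γ ∧ ∀ x ∈ S, ∀ s : Fin K, ∀ Δ : EuclideanSpace ℝ (Fin n),
    (∀ i, blk i ≠ s → Δ i = 0) → x + Δ ∈ S →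
      γ * ‖Δ‖ ^ 2 ≤ f (x + Δ) - f x - inner ℝ (gradient f x) Δ

/-- `y` is obtained from `x` by exact minimization of `F` over the block `s`, all other
blocks being kept. -/
def IsBlockUpdate {n K : ℕ} (blk : Fin n → Fin K) (F : EuclideanSpace ℝ (Fin n) → ℝ)
    (s : Fin K) (x y : EuclideanSpace ℝ (Fin n)) : Prop :=
  (∀ i, blk i ≠ s → y i = x i) ∧
    ∀ z : EuclideanSpace ℝ (Fin n), (∀ i, blk i ≠ s → z i = x i) → F y ≤ F z

/-- `x` is a sequence of iterates of block coordinate descent for `F`, the block `s r` being updated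
in the step from `x r` to `x (r + 1)`. -/
def IsBCDSequence {n K : ℕ} (blk : Fin n → Fin K) (F : EuclideanSpace ℝ (Fin n) → ℝ)
    (s : ℕ → Fin K) (x : ℕ → EuclideanSpace ℝ (Fin n)) : Prop :=
  ∀ r, IsBlockUpdate blk F (s r) (x r) (x (r + 1))

/-- The cyclic rule: the blocks are updated in the order `0, 1, …, K - 1, 0, 1, …`. -/
def IsCyclicRule {K : ℕ} (s : ℕ → Fin K) : Prop :=
  ∀ r, (s r : ℕ) = r % K

/-- An essentially cyclic rule: for some `N ≥ K`, each block is updated at least once in any `N`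
consecutive iterations. -/
def IsEssentiallyCyclicRule {K : ℕ} (s : ℕ → Fin K) : Prop :=
  ∃ N : ℕ, K ≤ N ∧ ∀ r : ℕ, ∀ k : Fin K, ∃ t : ℕ, r ≤ t ∧ t < r + N ∧ s t = k

/-- R-linear convergence: the distance to the limit is bounded by a geometric sequence. -/
def ConvergesRLinearlyTo {n : ℕ} (x : ℕ → EuclideanSpace ℝ (Fin n))
    (l : EuclideanSpace ℝ (Fin n)) : Prop :=
  ∃ C q : ℝ, 0 < q ∧ q < 1 ∧ ∀ r, ‖x r - l‖ ≤ C * q ^ r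

/-- For every cyclic or essentially cyclic rule and every starting point, block coordinate descent
for `F` is well defined (it generates exactly one sequence), and its iterates converge
R-linearly to a minimizer of `F`. -/
def BCDConvergesRLinearly {n K : ℕ} (blk : Fin n → Fin K)
    (F : EuclideanSpace ℝ (Fin n) → ℝ) : Prop :=
  ∀ s : ℕ → Fin K, IsCyclicRule s ∨ IsEssentiallyCyclicRule s →
    ∀ x₀ : EuclideanSpace ℝ (Fin n),
      (∃! x : ℕ → EuclideanSpace ℝ (Fin n), x 0 = x₀ ∧ IsBCDSequence blk F s x) ∧
      ∀ x : ℕ → EuclideanSpace ℝ (Fin n), x 0 = x₀ → IsBCDSequence blk F s x →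
        ∃ l ∈ optimalSet F, ConvergesRLinearlyTo x l

end

/-!
Why block coordinate descent converges linearly here. The lasso penalty is a group penalty with
singleton groups, and both losses have the form `∑ i, φ i ⟨aᵢ, x⟩` with scalar losses `φ i` that are
nonnegative, have Lipschitz derivatives and are strongly convex on bounded intervals
(`IsRegularLoss`). Block coordinate-wise strong convexity enters only through the consequence that
`x ↦ (⟨aᵢ, x⟩)ᵢ` is injective on each block.

The decisive fact is quadratic growth of the objective `F`: on a sublevel set the squared distance
to the minimizers is at most a constant times `F - min F` (`exists_quadratic_growth`). All minimizers
share the values `⟨aᵢ, x⟩` and the gradient `γ` of the loss, so `F - min F` splits into a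
Bregman distance of the loss and the excesses `w_J ‖x_J‖ + ⟨γ_J, x_J⟩ ≥ 0`. The former controls the
squared deviation of the `⟨aᵢ, x⟩`; the zero set of an excess with `w_J > 0` is a ray or the origin,
and the excess controls the squared distance to it on bounded sets (`exists_ray_error_bound`). Hence
the set of minimizers is a polyhedron, and a Hoffman-type error bound
(`exists_conformal_preimage`) turns small constraint violations into a small distance. Here the
sets need not be bounded: sublevel sets only bound the `⟨aᵢ, x⟩` and the penalized groups.

Along the iteration, an exact block step of length `δ` decreases `F` by at least `c δ ^ 2`
(`exists_sufficient_decrease`). After a window of `N` steps that updates every block, the optimality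
conditions at the last update of each block give a subgradient of `F` at the current iterate whose
norm is at most a constant times the path length of the window. This step needs the penalty to be
separable over the blocks (`exists_cost_to_go`). With quadratic growth, `F - min F` is then at
most a constant times the squared path length (`exists_suboptimality_le_path_sq`), so it contracts
by a fixed factor per window. The step lengths therefore decay geometrically and the iterates
converge R-linearly. The same bounds on sublevel sets show that each block subproblem has exactly
one solution.
-/

section

open Finset Filter Topology

/-! ### Hoffman-type error bound and geometric decay -/

/-- A linear map with no nonzero kernel vector in a closed cone is bounded below on that cone. -/
theorem exists_norm_le_mul_norm_of_closed_cone {E G : Type*} [NormedAddCommGroup E]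
    [NormedSpace ℝ E] [FiniteDimensional ℝ E] [NormedAddCommGroup G] [NormedSpace ℝ G]
    (M : E →L[ℝ] G) (C : Set E) (hC : IsClosed C)
    (hcone : ∀ k ∈ C, ∀ t : ℝ, 0 ≤ t → t • k ∈ C) (hker : ∀ k ∈ C, M k = 0 → k = 0) :
    ∃ θ : ℝ, 0 ≤ θ ∧ ∀ k ∈ C, ‖k‖ ≤ θ * ‖M k‖ := by
  have hcpt : IsCompact (Metric.sphere (0 : E) 1 ∩ C) := (isCompact_sphere 0 1).inter_right hC
  rcases (Metric.sphere (0 : E) 1 ∩ C).eq_empty_or_nonempty with he | hne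
  · refine ⟨0, le_rfl, fun k hk => ?_⟩
    by_contra! hpos
    have hk0 : 0 < ‖k‖ := by simpa using hpos
    have : ‖k‖⁻¹ • k ∈ Metric.sphere (0 : E) 1 ∩ C := by
      refine ⟨?_, hcone k hk _ (by positivity)⟩
      simp [norm_smul, hk0.ne']
    simp [he] at this
  · obtain ⟨k₀, ⟨hk₀s, hk₀C⟩, hmin⟩ :=
      hcpt.exists_isMinOn hne (f := fun k => ‖M k‖) (by fun_prop)
    have hM : 0 < ‖M k₀‖ := by
      rw [norm_pos_iff]
      intro h
      have := hker k₀ hk₀C h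
      simp [this] at hk₀s
    refine ⟨‖M k₀‖⁻¹, by positivity, fun k hk => ?_⟩
    rcases eq_or_ne k 0 with rfl | hk0
    · simp
    have hkp : 0 < ‖k‖ := norm_pos_iff.2 hk0
    have hmem : ‖k‖⁻¹ • k ∈ Metric.sphere (0 : E) 1 ∩ C := by
      refine ⟨?_, hcone k hk _ (by positivity)⟩
      simp [norm_smul, hkp.ne']
    have := isMinOn_iff.1 hmin _ hmem
    simp only [map_smul, norm_smul, norm_inv, norm_norm] at this
    rw [inv_mul_eq_div, le_div_iff₀ hkp] at this
    rw [inv_mul_eq_div, le_div_iff₀ hM]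
    linarith

/-- A form of Hoffman's error bound. Any `d` may be replaced by a vector `d'` with the same image
under `M`, of norm at most a constant times `‖M d‖`, and lying coordinatewise between `0` and `d`.
A coordinatewise constraint that holds at `τ` and `τ + d` then also holds at `τ + d'`. -/
theorem exists_conformal_preimage {ι G : Type*} [Fintype ι]
    [NormedAddCommGroup G] [NormedSpace ℝ G] (M : (ι → ℝ) →L[ℝ] G) :
    ∃ θ : ℝ, 0 ≤ θ ∧ ∀ d : ι → ℝ, ∃ d' : ι → ℝ, M d' = M d ∧
      (∀ i, d' i ∈ Set.uIcc 0 (d i)) ∧ ‖d'‖ ≤ θ * ‖M d‖ := by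
  classical
  -- the vectors whose sign pattern is a restriction of `σ`
  let C : (ι → SignType) → Set (ι → ℝ) := fun σ => {k | ∀ i, k i = (σ i : ℝ) * |k i|}
  have hCcl : ∀ σ, IsClosed (C σ) := fun σ => by
    simp only [C, Set.ofPred_forall]
    exact isClosed_iInter fun i => isClosed_eq (by fun_prop) (by fun_prop)
  have hθ : ∀ σ, ∃ θ : ℝ, 0 ≤ θ ∧ ((∀ k ∈ C σ, M k = 0 → k = 0) →
      ∀ k ∈ C σ, ‖k‖ ≤ θ * ‖M k‖) := fun σ => by
    by_cases h : ∀ k ∈ C σ, M k = 0 → k = 0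
    · obtain ⟨θ, h0, h1⟩ := exists_norm_le_mul_norm_of_closed_cone M (C σ) (hCcl σ)
        (fun k hk t ht i => by
          have := hk i
          simp only [Pi.smul_apply, smul_eq_mul, abs_mul, abs_of_nonneg ht]
          nth_rewrite 1 [this]; ring) h
      exact ⟨θ, h0, fun _ => h1⟩
    · exact ⟨0, le_rfl, fun h' => (h h').elim⟩
  choose θ hθ0 hθ1 using hθ
  refine ⟨∑ σ, θ σ, sum_nonneg fun σ _ => hθ0 σ, fun d => ?_⟩
  have hcpt : IsCompact {d' : ι → ℝ | M d' = M d ∧ ∀ i, d' i ∈ Set.uIcc 0 (d i)} := by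
    have : {d' : ι → ℝ | M d' = M d ∧ ∀ i, d' i ∈ Set.uIcc 0 (d i)} =
        (Set.univ.pi fun i => Set.uIcc 0 (d i)) ∩ {d' | M d' = M d} := by
      ext; simp only [Set.mem_ofPred_eq, Set.mem_inter_iff, Set.mem_univ_pi]; exact and_comm
    rw [this]
    exact (isCompact_univ_pi fun i => isCompact_uIcc).inter_right
      (isClosed_eq (by fun_prop) (by fun_prop))
  obtain ⟨d', ⟨hd'M, hd'box⟩, hmin⟩ := hcpt.exists_isMinOn ⟨d, rfl, fun i => Set.right_mem_uIcc⟩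
    (f := fun k => ∑ i, |k i|) (by fun_prop)
  refine ⟨d', hd'M, hd'box, ?_⟩
  have hd'C : d' ∈ C (fun i => SignType.sign (d' i)) := fun i => by simp
  -- by minimality of the `ℓ¹` norm, no kernel vector can be split off from `d'`
  have hker : ∀ k ∈ C (fun i => SignType.sign (d' i)), M k = 0 → k = 0 := by
    intro k hk hMk
    by_contra hk0
    have hev : ∀ᶠ ε in 𝓝[>] (0 : ℝ), ∀ i, ε * |k i| ≤ |d' i| := by
      rw [eventually_all]
      intro i
      by_cases h0 : d' i = 0
      · have hki := hk i
        simp only [h0, sign_zero, SignType.coe_zero, zero_mul] at hki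
        simp [hki]
      · have ht : Tendsto (fun ε : ℝ => ε * |k i|) (𝓝[>] 0) (𝓝 (0 * |k i|)) :=
          (Continuous.tendsto (by fun_prop) 0).mono_left nhdsWithin_le_nhds
        rw [zero_mul] at ht
        exact (ht.eventually_lt_const (abs_pos.2 h0)).mono fun _ h => h.le
    obtain ⟨ε, hε, hεpos⟩ := (hev.and self_mem_nhdsWithin).exists
    have hεpos : 0 < ε := hεpos
    have hcoord : ∀ i, (d' - ε • k) i = (SignType.sign (d' i) : ℝ) * (|d' i| - ε * |k i|) := by
      intro i
      have h1 := hd'C i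
      have h2 := hk i
      simp only [Pi.sub_apply, Pi.smul_apply, smul_eq_mul]
      nth_rewrite 1 [h1, h2]; ring
    have habs : ∀ i, |(d' - ε • k) i| = |d' i| - ε * |k i| := by
      intro i
      rw [hcoord, abs_mul, abs_of_nonneg (sub_nonneg.2 (hε i))]
      by_cases h0 : d' i = 0
      · have := hε i
        simp only [h0, abs_zero] at this ⊢
        have : ε * |k i| = 0 := le_antisymm this (by positivity)
        simp [this]
      · rcases lt_or_gt_of_ne h0 with h | h <;> simp [h]
    have hmem : d' - ε • k ∈ {d' : ι → ℝ | M d' = M d ∧ ∀ i, d' i ∈ Set.uIcc 0 (d i)} := by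
      refine ⟨by simp [hMk, hd'M], fun i => ?_⟩
      refine Set.uIcc_subset_uIcc_left (hd'box i) ?_
      have ha := habs i
      have hc := hcoord i
      have h3 : 0 ≤ ε * |k i| := by positivity
      have h4 := hε i
      rw [hc, Set.mem_uIcc]
      rcases lt_trichotomy (d' i) 0 with h | h | h
      · right; simp only [h, sign_neg, SignType.coe_neg_one]
        rw [abs_of_neg h] at h4 ⊢; constructor <;> linarith
      · left; simp [h]
      · left; simp only [h, sign_pos, SignType.coe_one]
        rw [abs_of_pos h] at h4 ⊢; constructor <;> linarith
    have hle := isMinOn_iff.1 hmin _ hmem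
    simp only [habs, sum_sub_distrib, ← mul_sum] at hle
    have hpos : 0 < ∑ i, |k i| := by
      obtain ⟨i, hi⟩ := Function.ne_iff.1 hk0
      exact sum_pos' (fun i _ => abs_nonneg _) ⟨i, mem_univ _, abs_pos.2 hi⟩
    nlinarith
  calc ‖d'‖ ≤ θ (fun i => SignType.sign (d' i)) * ‖M d'‖ := hθ1 _ hker d' hd'C
    _ ≤ (∑ σ, θ σ) * ‖M d'‖ := by
        gcongr
        exact single_le_sum (f := θ) (fun σ _ => hθ0 σ) (mem_univ _)
    _ = _ := by rw [hd'M]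

/-- A continuous function with a bounded sublevel set on a closed set attains its minimum there. -/
theorem exists_forall_le_of_isBounded_sublevel {E : Type*} [PseudoMetricSpace E] [ProperSpace E]
    {f : E → ℝ} (hf : Continuous f) {S : Set E} (hS : IsClosed S) {x₀ : E} (hx₀ : x₀ ∈ S)
    (hb : Bornology.IsBounded {x ∈ S | f x ≤ f x₀}) : ∃ y ∈ S, ∀ z ∈ S, f y ≤ f z := by
  have hcpt : IsCompact {x ∈ S | f x ≤ f x₀} :=
    Metric.isCompact_of_isClosed_isBounded (hS.inter (isClosed_le hf continuous_const)) hb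
  obtain ⟨y, ⟨hyS, hy⟩, hmin⟩ := hcpt.exists_isMinOn ⟨x₀, hx₀, le_rfl⟩ hf.continuousOn
  refine ⟨y, hyS, fun z hz => ?_⟩
  rcases le_total (f z) (f x₀) with h | h
  · exact isMinOn_iff.1 hmin z ⟨hz, h⟩
  · exact le_trans hy h

/-- A nonincreasing nonnegative sequence that contracts by a fixed factor over every window of `N`
steps decays geometrically. -/
theorem exists_geometric_bound {e : ℕ → ℝ} {N : ℕ} (hN : 0 < N) (he : Antitone e)
    (he0 : ∀ r, 0 ≤ e r) {ρ : ℝ} (hρ0 : 0 < ρ) (hρ1 : ρ < 1)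
    (hc : ∀ r, e (r + N) ≤ ρ * e r) :
    ∃ C q : ℝ, 0 ≤ C ∧ 0 < q ∧ q < 1 ∧ ∀ r, e r ≤ C * q ^ r := by
  set q : ℝ := ρ ^ (1 / (N : ℝ)) with hq
  have hN' : (0 : ℝ) < N := by exact_mod_cast hN
  have hq0 : 0 < q := Real.rpow_pos_of_pos hρ0 _
  have hq1 : q < 1 := Real.rpow_lt_one hρ0.le hρ1 (by positivity)
  have hqN : q ^ N = ρ := by
    rw [hq, ← Real.rpow_natCast, ← Real.rpow_mul hρ0.le]; field_simp; simp
  have hk : ∀ k, e (N * k) ≤ ρ ^ k * e 0 := by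
    intro k
    induction k with
    | zero => simp
    | succ k ih =>
      calc e (N * (k + 1)) ≤ ρ * e (N * k) := hc _
        _ ≤ ρ * (ρ ^ k * e 0) := by gcongr
        _ = _ := by ring
  refine ⟨e 0 / ρ, q, div_nonneg (he0 0) hρ0.le, hq0, hq1, fun r => ?_⟩
  have h1 : ρ * ρ ^ (r / N) ≤ q ^ r := by
    have hr : r = N * (r / N) + r % N := (Nat.div_add_mod r N).symm
    calc ρ * ρ ^ (r / N) = q ^ (N * (r / N) + N) := by rw [pow_add, pow_mul, hqN]; ring
      _ ≤ q ^ r := pow_le_pow_of_le_one hq0.le hq1.le (by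
        have := Nat.mod_lt r hN; omega)
  calc e r ≤ e (N * (r / N)) := he (Nat.mul_div_le r N)
    _ ≤ ρ ^ (r / N) * e 0 := hk _
    _ = e 0 / ρ * (ρ * ρ ^ (r / N)) := by field_simp
    _ ≤ _ := mul_le_mul_of_nonneg_left h1 (div_nonneg (he0 0) hρ0.le)

/-! ### Regular separable losses -/

/-- A finite family of scalar losses `φ i` with derivatives `φ' i`: nonnegative, with Lipschitz
derivatives, and strongly convex on bounded intervals. The derivatives enter only through the
tangent inequality `strong`. The constants are uniform in `i`. -/
structure IsRegularLoss {m : ℕ} (φ φ' : Fin m → ℝ → ℝ) : Prop where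
  nonneg : ∀ i t, 0 ≤ φ i t
  continuous : ∀ i, Continuous (φ i)
  lipschitz : ∃ L, 0 ≤ L ∧ ∀ i s t, |φ' i s - φ' i t| ≤ L * |s - t|
  strong : ∀ R, ∃ c, 0 < c ∧ ∀ i s t, |s| ≤ R → |t| ≤ R →
    c * (s - t) ^ 2 ≤ φ i s - φ i t - φ' i t * (s - t)

/-- The loss `∑ i, φ i ⟨aᵢ, x⟩`. -/
noncomputable def separableLoss {m n : ℕ} (φ : Fin m → ℝ → ℝ) (a : Fin m → EuclideanSpace ℝ (Fin n))
    (x : EuclideanSpace ℝ (Fin n)) : ℝ :=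
  ∑ i, φ i (inner ℝ (a i) x)

/-- The directional derivative `∑ i, φ' i ⟨aᵢ, x⟩ ⟨aᵢ, d⟩` at `x` in the direction `d` of the
separable loss. -/
noncomputable def separableLossDeriv {m n : ℕ} (φ' : Fin m → ℝ → ℝ) (a : Fin m → EuclideanSpace ℝ (Fin n))
    (x d : EuclideanSpace ℝ (Fin n)) : ℝ :=
  ∑ i, φ' i (inner ℝ (a i) x) * inner ℝ (a i) d

namespace IsRegularLoss

variable {m n : ℕ} {φ φ' : Fin m → ℝ → ℝ} {a : Fin m → EuclideanSpace ℝ (Fin n)}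

theorem tangent_le (h : IsRegularLoss φ φ') (i : Fin m) (s t : ℝ) :
    0 ≤ φ i s - φ i t - φ' i t * (s - t) := by
  obtain ⟨c, hc, hs⟩ := h.strong (max |s| |t|)
  exact le_trans (by positivity) (hs i s t (le_max_left _ _) (le_max_right _ _))

/-- A bounded Bregman distance to points of a bounded interval confines its first argument to a
bounded interval: beyond distance `1` from the base point it grows at least linearly. -/
theorem exists_abs_le_of_bregman_le (h : IsRegularLoss φ φ') (T M : ℝ) :
    ∃ R, ∀ i s t, |t| ≤ T → φ i s - φ i t - φ' i t * (s - t) ≤ M → |s| ≤ R := by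
  obtain ⟨c, hc, hstr⟩ := h.strong (T + 1)
  refine ⟨T + 1 + |M| / c, fun i s t ht hM => ?_⟩
  have hMc : 0 ≤ |M| / c := by positivity
  have hst : |s| ≤ |t| + |s - t| := by
    have := abs_add_le t (s - t); simpa using this
  by_cases h1 : |s - t| ≤ 1
  · linarith
  push Not at h1
  set l := |s - t| with hl
  have hl0 : 0 < l := by linarith
  -- the point at distance `1` from `t` in the direction of `s`
  set u := t + (s - t) / l with hu
  have hut : |u - t| = 1 := by
    simp only [hu, add_sub_cancel_left, abs_div, abs_of_pos hl0, ← hl]; field_simp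
  have hua : |u| ≤ T + 1 := by
    have := abs_add_le t (u - t)
    rw [add_sub_cancel, hut] at this; linarith
  have h2 := hstr i u t hua (by linarith)
  rw [← sq_abs, hut] at h2
  have h3 := h.tangent_le i s u
  have h4 := h.tangent_le i t u
  have e1 : s - t = l * (u - t) := by simp only [hu]; field_simp; ring
  have e2 : s - u = (l - 1) * (u - t) := by linarith [e1]
  -- convexity of `φ i` along the segment from `t` to `s`
  have h5 : c * l ≤ M := by
    have : l * (φ i u - φ i t - φ' i t * (u - t)) ≤ φ i s - φ i t - φ' i t * (s - t) := by
      rw [e1]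
      rw [e2] at h3
      nlinarith
    nlinarith
  have h6 : l ≤ |M| / c := by
    rw [le_div_iff₀ hc]; nlinarith [le_abs_self M]
  linarith

theorem continuous_separableLoss (h : IsRegularLoss φ φ') : Continuous (separableLoss φ a) := by
  unfold separableLoss
  exact continuous_finsetSum _ fun i _ => (h.continuous i).comp (by fun_prop)

theorem separableLoss_nonneg (h : IsRegularLoss φ φ') (x : EuclideanSpace ℝ (Fin n)) :
    0 ≤ separableLoss φ a x :=
  sum_nonneg fun i _ => h.nonneg i _

end IsRegularLoss

section Deriv

variable {m n : ℕ} {φ φ' : Fin m → ℝ → ℝ} {a : Fin m → EuclideanSpace ℝ (Fin n)}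

theorem bregman_separableLoss (x y : EuclideanSpace ℝ (Fin n)) :
    separableLoss φ a x - separableLoss φ a y - separableLossDeriv φ' a y (x - y) =
      ∑ i, (φ i (inner ℝ (a i) x) - φ i (inner ℝ (a i) y) -
        φ' i (inner ℝ (a i) y) * (inner ℝ (a i) x - inner ℝ (a i) y)) := by
  simp only [separableLoss, separableLossDeriv, inner_sub_right, sum_sub_distrib]

theorem separableLossDeriv_smul (x d : EuclideanSpace ℝ (Fin n)) (t : ℝ) :
    separableLossDeriv φ' a x (t • d) = t * separableLossDeriv φ' a x d := by
  simp only [separableLossDeriv, inner_smul_right, mul_sum]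
  exact sum_congr rfl fun i _ => by ring

theorem separableLossDeriv_sum {ι : Type*} (s : Finset ι) (x : EuclideanSpace ℝ (Fin n))
    (d : ι → EuclideanSpace ℝ (Fin n)) :
    separableLossDeriv φ' a x (∑ k ∈ s, d k) = ∑ k ∈ s, separableLossDeriv φ' a x (d k) := by
  simp only [separableLossDeriv, inner_sum, mul_sum]
  exact sum_comm

theorem separableLossDeriv_eq_inner (x d : EuclideanSpace ℝ (Fin n)) :
    separableLossDeriv φ' a x d = inner ℝ (∑ i, φ' i (inner ℝ (a i) x) • a i) d := by
  simp only [separableLossDeriv, sum_inner, real_inner_smul_left]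

namespace IsRegularLoss

theorem deriv_le_sub (h : IsRegularLoss φ φ') (x y : EuclideanSpace ℝ (Fin n)) :
    separableLossDeriv φ' a y (x - y) ≤ separableLoss φ a x - separableLoss φ a y := by
  have := bregman_separableLoss (φ := φ) (φ' := φ') (a := a) x y
  have h2 := sum_nonneg fun i (_ : i ∈ univ) =>
    h.tangent_le i (inner ℝ (a i) x) (inner ℝ (a i) y)
  linarith

theorem exists_abs_deriv_sub_le (h : IsRegularLoss φ φ')
    (a : Fin m → EuclideanSpace ℝ (Fin n)) :
    ∃ L, 0 ≤ L ∧ ∀ x y d, |separableLossDeriv φ' a x d - separableLossDeriv φ' a y d| ≤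
      L * (‖x - y‖ * ‖d‖) := by
  obtain ⟨L, hL0, hL⟩ := h.lipschitz
  refine ⟨∑ i, L * ‖a i‖ ^ 2, sum_nonneg fun i _ => by positivity, fun x y d => ?_⟩
  simp only [separableLossDeriv, ← sum_sub_distrib, ← sub_mul, sum_mul]
  refine (abs_sum_le_sum_abs _ _).trans (sum_le_sum fun i _ => ?_)
  rw [abs_mul]
  calc _ ≤ L * |inner ℝ (a i) x - inner ℝ (a i) y| * |inner ℝ (a i) d| := by
        gcongr; exact hL i _ _
    _ ≤ L * (‖a i‖ * ‖x - y‖) * (‖a i‖ * ‖d‖) := by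
        rw [← inner_sub_right]
        gcongr <;> exact abs_real_inner_le_norm _ _
    _ = _ := by ring

/-- First-order optimality along a segment for the sum of a regular loss and a convex penalty. -/
theorem first_order (h : IsRegularLoss φ φ') {P : EuclideanSpace ℝ (Fin n) → ℝ}
    (hP : ConvexOn ℝ Set.univ P) {y z : EuclideanSpace ℝ (Fin n)}
    (hmin : ∀ t : ℝ, separableLoss φ a y + P y ≤
      separableLoss φ a (y + t • (z - y)) + P (y + t • (z - y))) :
    0 ≤ P z - P y + separableLossDeriv φ' a y (z - y) := by
  obtain ⟨L, hL0, hL⟩ := h.exists_abs_deriv_sub_le a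
  have key : ∀ t : ℝ, t ∈ Set.Ioo (0 : ℝ) 1 →
      -(L * ‖z - y‖ ^ 2 * t) ≤ P z - P y + separableLossDeriv φ' a y (z - y) := by
    intro t ⟨ht0, ht1⟩
    have h1 := hmin t
    have h2 := h.deriv_le_sub (a := a) y (y + t • (z - y))
    have e : y - (y + t • (z - y)) = (-t) • (z - y) := by module
    rw [e, separableLossDeriv_smul] at h2
    have h3 : P (y + t • (z - y)) ≤ (1 - t) * P y + t * P z := by
      have := hP.2 (Set.mem_univ y) (Set.mem_univ z) (sub_nonneg.2 ht1.le) ht0.le (by ring)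
      have e2 : (1 - t) • y + t • z = y + t • (z - y) := by module
      simpa [e2] using this
    have h4 := (abs_le.1 (hL (y + t • (z - y)) y (z - y))).2
    have e3 : ‖y + t • (z - y) - y‖ = t * ‖z - y‖ := by
      simp [norm_smul, abs_of_pos ht0]
    rw [e3] at h4
    have h5 : 0 ≤ t * (P z - P y + separableLossDeriv φ' a (y + t • (z - y)) (z - y)) := by
      nlinarith
    have h6 := nonneg_of_mul_nonneg_right h5 ht0
    nlinarith
  have ht : Tendsto (fun t : ℝ => -(L * ‖z - y‖ ^ 2 * t)) (𝓝[>] 0)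
      (𝓝 (-(L * ‖z - y‖ ^ 2 * 0))) :=
    (Continuous.tendsto (by fun_prop) 0).mono_left nhdsWithin_le_nhds
  rw [mul_zero, neg_zero] at ht
  exact le_of_tendsto ht (mem_of_superset (Ioo_mem_nhdsGT one_pos) key)

end IsRegularLoss

end Deriv

/-! ### Group penalties and quadratic growth -/

section Subvector

variable {n p : ℕ} (c : Fin n → Fin p)

theorem subvector_apply (J : Fin p) (x : EuclideanSpace ℝ (Fin n)) (i : {i // c i = J}) :
    subvector c J x i = x i.1 := rfl

theorem subvector_add (J : Fin p) (x y : EuclideanSpace ℝ (Fin n)) :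
    subvector c J (x + y) = subvector c J x + subvector c J y := rfl

theorem subvector_sub (J : Fin p) (x y : EuclideanSpace ℝ (Fin n)) :
    subvector c J (x - y) = subvector c J x - subvector c J y := rfl

theorem subvector_smul (J : Fin p) (t : ℝ) (x : EuclideanSpace ℝ (Fin n)) :
    subvector c J (t • x) = t • subvector c J x := rfl

theorem subvector_neg (J : Fin p) (x : EuclideanSpace ℝ (Fin n)) :
    subvector c J (-x) = -subvector c J x := rfl

theorem continuous_subvector (J : Fin p) : Continuous (subvector c J) := by
  unfold subvector; fun_prop

theorem sum_inner_subvector (x y : EuclideanSpace ℝ (Fin n)) :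
    ∑ J, inner ℝ (subvector c J x) (subvector c J y) = inner ℝ x y := by
  simp only [PiLp.inner_apply, subvector_apply]
  exact Fintype.sum_fiberwise c fun i => inner ℝ (x i) (y i)

theorem sum_norm_sq_subvector (x : EuclideanSpace ℝ (Fin n)) :
    ∑ J, ‖subvector c J x‖ ^ 2 = ‖x‖ ^ 2 := by
  simp only [← real_inner_self_eq_norm_sq, sum_inner_subvector]

/-- The vector that agrees with `x` on the coordinates labelled `J` and vanishes elsewhere. -/
noncomputable def blockPart (J : Fin p) (x : EuclideanSpace ℝ (Fin n)) :
    EuclideanSpace ℝ (Fin n) :=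
  WithLp.toLp 2 fun i => if c i = J then x i else 0

theorem blockPart_apply (J : Fin p) (x : EuclideanSpace ℝ (Fin n)) (i : Fin n) :
    blockPart c J x i = if c i = J then x i else 0 := rfl

theorem sum_blockPart (x : EuclideanSpace ℝ (Fin n)) : ∑ J, blockPart c J x = x := by
  ext i
  simp [blockPart_apply]

theorem subvector_blockPart_self (J : Fin p) (x : EuclideanSpace ℝ (Fin n)) :
    subvector c J (blockPart c J x) = subvector c J x := by
  ext i
  simp [subvector_apply, blockPart_apply, i.2]

theorem subvector_blockPart_of_ne {J J' : Fin p} (h : J' ≠ J) (x : EuclideanSpace ℝ (Fin n)) :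
    subvector c J' (blockPart c J x) = 0 := by
  ext i
  simp [subvector_apply, blockPart_apply, i.2, h]

theorem norm_blockPart_le (J : Fin p) (x : EuclideanSpace ℝ (Fin n)) :
    ‖blockPart c J x‖ ≤ ‖x‖ := by
  rw [EuclideanSpace.norm_eq, EuclideanSpace.norm_eq]
  refine Real.sqrt_le_sqrt (sum_le_sum fun i _ => ?_)
  rw [blockPart_apply]
  split_ifs <;> simp [sq_nonneg]

theorem continuous_groupPenalty (w : Fin p → ℝ) : Continuous (groupPenalty c w) := by
  unfold groupPenalty
  exact continuous_finsetSum _ fun J _ => continuous_const.mul (continuous_subvector c J).norm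

theorem convexOn_groupPenalty {w : Fin p → ℝ} (hw : ∀ J, 0 ≤ w J) :
    ConvexOn ℝ Set.univ (groupPenalty c w) := by
  refine ⟨convex_univ, fun x _ y _ s t hs ht _ => ?_⟩
  simp only [groupPenalty, smul_eq_mul, mul_sum, ← sum_add_distrib]
  refine sum_le_sum fun J _ => ?_
  have : ‖subvector c J (s • x + t • y)‖ ≤ s * ‖subvector c J x‖ + t * ‖subvector c J y‖ := by
    rw [subvector_add, subvector_smul, subvector_smul]
    refine (norm_add_le _ _).trans (le_of_eq ?_)
    rw [norm_smul, norm_smul, Real.norm_of_nonneg hs, Real.norm_of_nonneg ht]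
  calc _ ≤ w J * _ := mul_le_mul_of_nonneg_left this (hw J)
    _ = _ := by ring

theorem groupPenalty_nonneg {w : Fin p → ℝ} (hw : ∀ J, 0 ≤ w J)
    (x : EuclideanSpace ℝ (Fin n)) : 0 ≤ groupPenalty c w x :=
  sum_nonneg fun J _ => mul_nonneg (hw J) (norm_nonneg _)

end Subvector

/-- The linear map `x ↦ (⟨aᵢ, x⟩)ᵢ`. -/
noncomputable def innerMap {m n : ℕ} (a : Fin m → EuclideanSpace ℝ (Fin n)) :
    EuclideanSpace ℝ (Fin n) →L[ℝ] EuclideanSpace ℝ (Fin m) :=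
  LinearMap.toContinuousLinearMap
    { toFun := fun x => WithLp.toLp 2 fun i => inner ℝ (a i) x
      map_add' := fun x y => by ext; simp [inner_add_right]
      map_smul' := fun t x => by ext; simp [inner_smul_right] }

theorem innerMap_apply {m n : ℕ} (a : Fin m → EuclideanSpace ℝ (Fin n))
    (x : EuclideanSpace ℝ (Fin n)) (i : Fin m) : innerMap a x i = inner ℝ (a i) x := rfl

theorem norm_sq_innerMap {m n : ℕ} (a : Fin m → EuclideanSpace ℝ (Fin n))
    (x : EuclideanSpace ℝ (Fin n)) : ‖innerMap a x‖ ^ 2 = ∑ i, inner ℝ (a i) x ^ 2 := by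
  simp [EuclideanSpace.norm_sq_eq, innerMap_apply]

section Ray

variable {H : Type*} [NormedAddCommGroup H] [InnerProductSpace ℝ H]

theorem norm_mul_add_inner_nonneg {w : ℝ} {γ : H} (hγ : ‖γ‖ ≤ w) (v : H) :
    0 ≤ w * ‖v‖ + inner ℝ γ v := by
  have h1 := (abs_le.1 (abs_real_inner_le_norm γ v)).1
  nlinarith [norm_nonneg v]

/-- For `‖γ‖ ≤ w` the function `v ↦ w ‖v‖ + ⟨γ, v⟩` vanishes on the ray spanned by some `q`
(which is `0` if `‖γ‖ < w`) and, on bounded sets, bounds the squared distance to that ray. -/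
theorem exists_ray_error_bound {w : ℝ} (hw : 0 ≤ w) {γ : H} (hγ : ‖γ‖ ≤ w) :
    ∃ q : H, ∃ C : ℝ, 0 ≤ C ∧ (∀ t : ℝ, 0 ≤ t → w * ‖t • q‖ + inner ℝ γ (t • q) = 0) ∧
      (w ≠ 0 → ∀ v : H, ∃ t : ℝ, 0 ≤ t ∧
        ‖v - t • q‖ ^ 2 ≤ C * ‖v‖ * (w * ‖v‖ + inner ℝ γ v)) := by
  rcases hγ.lt_or_eq with hlt | heq
  · refine ⟨0, (w - ‖γ‖)⁻¹, inv_nonneg.2 (sub_nonneg.2 hγ), by simp, fun _ v => ⟨0, le_rfl, ?_⟩⟩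
    have h0 : 0 < w - ‖γ‖ := sub_pos.2 hlt
    have h1 := (abs_le.1 (abs_real_inner_le_norm γ v)).1
    have h2 : (w - ‖γ‖) * ‖v‖ ≤ w * ‖v‖ + inner ℝ γ v := by linarith
    calc ‖v - (0 : ℝ) • (0 : H)‖ ^ 2 = (w - ‖γ‖)⁻¹ * ‖v‖ * ((w - ‖γ‖) * ‖v‖) := by
          simp only [smul_zero, sub_zero]; field_simp
      _ ≤ _ := by gcongr
  · rcases hw.eq_or_lt with h0 | hpos
    · refine ⟨0, 0, le_rfl, by simp, fun h => (h h0.symm).elim⟩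
    · set q : H := -(w⁻¹ • γ) with hq
      have hqn : ‖q‖ = 1 := by
        rw [hq, norm_neg, norm_smul, heq, norm_inv, Real.norm_of_nonneg hw]; field_simp
      have hγq : γ = -(w • q) := by rw [hq]; simp [smul_smul, hpos.ne']
      have hin : ∀ v, inner ℝ γ v = -(w * inner ℝ q v) := fun v => by
        rw [hγq, inner_neg_left, real_inner_smul_left]
      refine ⟨q, 2 / w, by positivity, fun t ht => ?_, fun _ v => ?_⟩
      · rw [hin, real_inner_smul_right, real_inner_self_eq_norm_sq, norm_smul, hqn,
          Real.norm_of_nonneg ht]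
        ring
      · have hqv : inner ℝ q v ≤ ‖v‖ := by
          have := (abs_le.1 (abs_real_inner_le_norm q v)).2
          rwa [hqn, one_mul] at this
        have e : 2 / w * ‖v‖ * (w * ‖v‖ + inner ℝ γ v) = 2 * ‖v‖ * (‖v‖ - inner ℝ q v) := by
          rw [hin]; field_simp; ring
        rw [e]
        rcases le_total 0 (inner ℝ q v) with h | h
        · refine ⟨inner ℝ q v, h, ?_⟩
          rw [norm_sub_sq_real, real_inner_smul_right, norm_smul, hqn, Real.norm_of_nonneg h,
            real_inner_comm q v]
          nlinarith
        · refine ⟨0, le_rfl, ?_⟩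
          rw [zero_smul, sub_zero]
          nlinarith [norm_nonneg v]

end Ray

section Growth

variable {m n p : ℕ} {φ φ' : Fin m → ℝ → ℝ} {a : Fin m → EuclideanSpace ℝ (Fin n)}
  {g : Fin n → Fin p} {w : Fin p → ℝ} {xs : EuclideanSpace ℝ (Fin n)}

/-- The excess of the term `w_J ‖x_J‖` over its linear minorant `-⟨γ_J, x_J⟩`. -/
noncomputable def groupExcess (g : Fin n → Fin p) (w : Fin p → ℝ)
    (γ : EuclideanSpace ℝ (Fin n)) (J : Fin p) (x : EuclideanSpace ℝ (Fin n)) : ℝ :=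
  w J * ‖subvector g J x‖ + inner ℝ (subvector g J γ) (subvector g J x)

theorem sum_groupExcess (γ x : EuclideanSpace ℝ (Fin n)) :
    ∑ J, groupExcess g w γ J x = groupPenalty g w x + inner ℝ γ x := by
  simp only [groupExcess, groupPenalty, sum_add_distrib, sum_inner_subvector]

/-- First-order optimality at a minimizer, with `γ` the gradient of the loss there: every group of
`γ` is dominated by its weight, and the excesses of the minimizer vanish. -/
theorem optimality_conditions (h : IsRegularLoss φ φ') (hw : ∀ J, 0 ≤ w J)
    (hxs : xs ∈ optimalSet fun x => separableLoss φ a x + groupPenalty g w x) :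
    ∃ γ : EuclideanSpace ℝ (Fin n), (∀ J, ‖subvector g J γ‖ ≤ w J) ∧
      (∀ d, separableLossDeriv φ' a xs d = inner ℝ γ d) ∧
      groupPenalty g w xs + inner ℝ γ xs = 0 := by
  set γ := ∑ i, φ' i (inner ℝ (a i) xs) • a i with hγ
  have hfo : ∀ z, groupPenalty g w xs + inner ℝ γ xs ≤ groupPenalty g w z + inner ℝ γ z := by
    intro z
    have := h.first_order (a := a) (convexOn_groupPenalty g hw) (y := xs) (z := z)
      fun t => hxs _
    rw [separableLossDeriv_eq_inner, inner_sub_right] at this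
    linarith
  have hsm : ∀ t : ℝ, 0 ≤ t → groupPenalty g w (t • xs) = t * groupPenalty g w xs := by
    intro t ht
    simp only [groupPenalty, subvector_smul, norm_smul, Real.norm_of_nonneg ht, mul_sum]
    exact sum_congr rfl fun J _ => by ring
  -- the linearized objective is positively homogeneous, so its minimum value is `0`
  have h0 : groupPenalty g w xs + inner ℝ γ xs = 0 := by
    have h1 := hfo ((0 : ℝ) • xs)
    have h2 := hfo ((2 : ℝ) • xs)
    rw [hsm _ (by norm_num), real_inner_smul_right] at h1 h2
    linarith
  refine ⟨γ, fun J => ?_, separableLossDeriv_eq_inner xs, h0⟩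
  have h1 := hfo (blockPart g J (-γ))
  rw [h0, ← sum_groupExcess, sum_eq_single J] at h1
  · rw [groupExcess, subvector_blockPart_self, subvector_neg, norm_neg, inner_neg_right,
      real_inner_self_eq_norm_sq] at h1
    by_contra! hlt
    have := (hw J).trans_lt hlt
    nlinarith
  · intro J' _ hJ
    simp [groupExcess, subvector_blockPart_of_ne g hJ]
  · simp

/-- The loss arguments `⟨aᵢ, y⟩` are bounded on every sublevel set. -/
theorem exists_abs_inner_le_of_sublevel (h : IsRegularLoss φ φ') (hw : ∀ J, 0 ≤ w J)
    (hxs : xs ∈ optimalSet fun x => separableLoss φ a x + groupPenalty g w x) (M : ℝ) :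
    ∃ R, ∀ y, separableLoss φ a y + groupPenalty g w y ≤
      separableLoss φ a xs + groupPenalty g w xs + M → ∀ i, |inner ℝ (a i) y| ≤ R := by
  obtain ⟨R, hR⟩ := h.exists_abs_le_of_bregman_le (∑ i, |inner ℝ (a i) xs|) M
  refine ⟨R, fun y hy i => hR i _ (inner ℝ (a i) xs) ?_ ?_⟩
  · exact single_le_sum (f := fun i => |inner ℝ (a i) xs|) (fun _ _ => abs_nonneg _) (mem_univ i)
  · have h1 := bregman_separableLoss (φ := φ) (φ' := φ') (a := a) y xs
    have h2 := h.first_order (a := a) (convexOn_groupPenalty g hw) (y := xs) (z := y)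
      fun t => hxs _
    have h3 := single_le_sum (f := fun i => φ i (inner ℝ (a i) y) - φ i (inner ℝ (a i) xs) -
      φ' i (inner ℝ (a i) xs) * (inner ℝ (a i) y - inner ℝ (a i) xs))
      (fun i _ => h.tangent_le i _ _) (mem_univ i)
    linarith

/-- Quadratic growth on sublevel sets: the squared distance to the minimizers is at most a constant
times the suboptimality. The minimizers form a polyhedron, cut out by the values `⟨aᵢ, x⟩` and by a
ray (or the origin) in each penalized group; the suboptimality controls the squared
violation of these constraints, and `exists_conformal_preimage` repairs it. -/
theorem exists_quadratic_growth (h : IsRegularLoss φ φ') (hw : ∀ J, 0 ≤ w J)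
    (hxs : xs ∈ optimalSet fun x => separableLoss φ a x + groupPenalty g w x) (M : ℝ) :
    ∃ C, 0 ≤ C ∧ ∀ y, separableLoss φ a y + groupPenalty g w y ≤
      separableLoss φ a xs + groupPenalty g w xs + M →
      ∃ z ∈ optimalSet fun x => separableLoss φ a x + groupPenalty g w x,
        ‖y - z‖ ^ 2 ≤ C * (separableLoss φ a y + groupPenalty g w y -
          (separableLoss φ a xs + groupPenalty g w xs)) := by
  obtain ⟨γ, hγw, hγd, hγ0⟩ := optimality_conditions h hw hxs
  set F := fun x => separableLoss φ a x + groupPenalty g w x with hF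
  change ∃ C, 0 ≤ C ∧ ∀ y, F y ≤ F xs + M → ∃ z ∈ optimalSet F, ‖y - z‖ ^ 2 ≤ C * (F y - F xs)
  have hEx : ∀ J x, 0 ≤ groupExcess g w γ J x := fun J x => norm_mul_add_inner_nonneg (hγw J) _
  -- suboptimality = Bregman distance + total excess
  have hsplit : ∀ y, F y - F xs =
      ∑ i, (φ i (inner ℝ (a i) y) - φ i (inner ℝ (a i) xs) -
        φ' i (inner ℝ (a i) xs) * (inner ℝ (a i) y - inner ℝ (a i) xs)) +
      ∑ J, groupExcess g w γ J y := by
    intro y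
    rw [← bregman_separableLoss, sum_groupExcess, hγd, inner_sub_right]
    simp only [hF]; linarith
  have hBreg0 : ∀ y, 0 ≤ ∑ i, (φ i (inner ℝ (a i) y) - φ i (inner ℝ (a i) xs) -
        φ' i (inner ℝ (a i) xs) * (inner ℝ (a i) y - inner ℝ (a i) xs)) :=
    fun y => sum_nonneg fun i _ => h.tangent_le i _ _
  have hExle : ∀ J y, groupExcess g w γ J y ≤ F y - F xs := fun J y => by
    have h1 := single_le_sum (f := fun J => groupExcess g w γ J y) (fun J _ => hEx J y)
      (mem_univ J)
    have h2 := hBreg0 y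
    have h3 := hsplit y
    linarith
  -- the loss part of the growth
  obtain ⟨c, hc, hloss⟩ : ∃ c, 0 < c ∧ ∀ y, F y ≤ F xs + M →
      c * ‖innerMap a (y - xs)‖ ^ 2 ≤ F y - F xs := by
    obtain ⟨R, hR⟩ := exists_abs_inner_le_of_sublevel h hw hxs (max M 0)
    obtain ⟨c, hc, hs⟩ := h.strong R
    refine ⟨c, hc, fun y hy => ?_⟩
    have h1 := hR y (hy.trans (by gcongr; exact le_max_left _ _))
    have h2 := hR xs (by simp)
    rw [norm_sq_innerMap, mul_sum, hsplit]
    refine le_trans (sum_le_sum fun i _ => ?_)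
      (le_add_of_nonneg_right (sum_nonneg fun J _ => hEx J y))
    rw [inner_sub_right]
    exact hs i _ _ (h1 i) (h2 i)
  -- the rays that carry the penalized groups of the minimizers
  choose q Cq hCq hq hray using fun J => exists_ray_error_bound (hw J) (hγw J)
  have hτ : ∀ J (v : EuclideanSpace ℝ {i // g i = J}), ∃ t : ℝ, 0 ≤ t ∧ (w J ≠ 0 →
      ‖v - t • q J‖ ^ 2 ≤ Cq J * ‖v‖ * (w J * ‖v‖ + inner ℝ (subvector g J γ) v)) := by
    intro J v
    by_cases hJ : w J = 0
    · exact ⟨0, le_rfl, fun h => (h hJ).elim⟩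
    · obtain ⟨t, ht, h1⟩ := hray J hJ v
      exact ⟨t, ht, fun _ => h1⟩
  choose τ hτ0 hτ1 using hτ
  -- parametrization by the unpenalized coordinates and the positions on the rays
  let B : (Fin n ⊕ Fin p → ℝ) →L[ℝ] EuclideanSpace ℝ (Fin n) := LinearMap.toContinuousLinearMap
    { toFun := fun k => WithLp.toLp 2 fun i =>
        if w (g i) = 0 then k (Sum.inl i) else k (Sum.inr (g i)) * q (g i) ⟨i, rfl⟩
      map_add' := fun k k' => by
        ext i; simp only [PiLp.add_apply, Pi.add_apply]; split_ifs <;> ring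
      map_smul' := fun t k => by
        ext i
        simp only [PiLp.smul_apply, Pi.smul_apply, smul_eq_mul, RingHom.id_apply]
        split_ifs <;> ring }
  have hB0 : ∀ k J, w J = 0 → ∀ i : {i // g i = J}, subvector g J (B k) i = k (Sum.inl i.1) := by
    rintro k J hJ ⟨i, rfl⟩
    exact if_pos hJ
  have hB1 : ∀ k J, w J ≠ 0 → subvector g J (B k) = k (Sum.inr J) • q J := by
    intro k J hJ
    ext ⟨i, hi⟩
    subst hi
    exact if_neg hJ
  let κ : EuclideanSpace ℝ (Fin n) → Fin n ⊕ Fin p → ℝ :=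
    fun y => Sum.elim (fun i => y i) (fun J => τ J (subvector g J y))
  obtain ⟨C₁, hC₁, hproj⟩ : ∃ C₁, 0 ≤ C₁ ∧ ∀ y, F y ≤ F xs + max M 0 →
      ‖y - B (κ y)‖ ^ 2 ≤ C₁ * (F y - F xs) := by
    have hK : 0 ≤ F xs + max M 0 := add_nonneg
      (add_nonneg (h.separableLoss_nonneg _) (groupPenalty_nonneg g hw _)) (le_max_right _ _)
    refine ⟨∑ J, Cq J * ((F xs + max M 0) / w J), sum_nonneg fun J _ =>
      mul_nonneg (hCq J) (div_nonneg hK (hw J)), fun y hy => ?_⟩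
    have hFy : 0 ≤ F y - F xs := sub_nonneg.2 (hxs y)
    rw [← sum_norm_sq_subvector g, sum_mul]
    refine sum_le_sum fun J _ => ?_
    rw [subvector_sub]
    by_cases hJ : w J = 0
    · have : subvector g J y - subvector g J (B (κ y)) = 0 := by
        ext i
        rw [PiLp.sub_apply, hB0 _ J hJ]
        simp [κ, subvector_apply]
      rw [this]
      rw [norm_zero, zero_pow two_ne_zero]
      exact mul_nonneg (mul_nonneg (hCq J) (div_nonneg hK (hw J))) hFy
    · have hJp : 0 < w J := lt_of_le_of_ne (hw J) (Ne.symm hJ)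
      rw [hB1 _ J hJ]
      refine (hτ1 J _ hJ).trans ?_
      have h1 : ‖subvector g J y‖ ≤ (F xs + max M 0) / w J := by
        rw [le_div_iff₀ hJp, mul_comm]
        have h2 := single_le_sum (f := fun J => w J * ‖subvector g J y‖)
          (fun J _ => mul_nonneg (hw J) (norm_nonneg _)) (mem_univ J)
        refine le_trans h2 (le_trans ?_ hy)
        exact le_add_of_nonneg_left (h.separableLoss_nonneg y)
      have h3 := hExle J y
      have h4 := hEx J y
      rw [groupExcess] at h3 h4
      have := hCq J
      gcongr
  have hxsB : B (κ xs) = xs := by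
    have := hproj xs (by simp)
    rw [sub_self, mul_zero] at this
    have h2 : ‖xs - B (κ xs)‖ = 0 := by
      rw [← sq_eq_zero_iff]; exact le_antisymm this (sq_nonneg _)
    exact (sub_eq_zero.1 (norm_eq_zero.1 h2)).symm
  obtain ⟨θ, hθ0, hθ⟩ := exists_conformal_preimage ((innerMap a).comp B)
  set β := ‖B‖ * θ with hβ
  have hβ0 : 0 ≤ β := by positivity
  set α := ‖innerMap a‖ with hα
  refine ⟨2 * (1 + β * α) ^ 2 * C₁ + 2 * β ^ 2 / c, by positivity, fun y hy => ?_⟩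
  obtain ⟨d', hd'M, hd'box, hd'n⟩ := hθ (κ xs - κ y)
  have hA : innerMap a (B (κ y + d')) = innerMap a xs := by
    have : innerMap a (B d') = innerMap a (B (κ xs - κ y)) := hd'M
    rw [map_add, map_add, this, map_sub, map_sub, hxsB]; abel
  have hnn : ∀ J, 0 ≤ (κ y + d') (Sum.inr J) := by
    intro J
    have h1 := hd'box (Sum.inr J)
    have h2 : 0 ≤ κ y (Sum.inr J) := hτ0 J _
    have h3 : 0 ≤ κ xs (Sum.inr J) := hτ0 J _
    simp only [Pi.sub_apply, Set.mem_uIcc] at h1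
    simp only [Pi.add_apply]
    rcases h1 with h1 | h1 <;> linarith
  have hzF : F (B (κ y + d')) = F xs := by
    have hin : ∀ i, inner ℝ (a i) (B (κ y + d')) = inner ℝ (a i) xs := fun i => by
      rw [← innerMap_apply, hA, innerMap_apply]
    have h1 : ∀ J, groupExcess g w γ J (B (κ y + d')) = 0 := by
      intro J
      by_cases hJ : w J = 0
      · have : subvector g J γ = 0 := norm_le_zero_iff.1 ((hγw J).trans_eq hJ)
        simp [groupExcess, this, hJ]
      · rw [groupExcess, hB1 _ J hJ]
        exact hq J _ (hnn J)
    have := hsplit (B (κ y + d'))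
    simp only [hin, h1, sub_self, mul_zero, sum_const_zero, add_zero] at this
    linarith
  refine ⟨B (κ y + d'), fun x => hzF.trans_le (hxs x), ?_⟩
  set Δ := F y - F xs with hΔ
  have hp := hproj y (hy.trans (by gcongr; exact le_max_left _ _))
  have hl := hloss y hy
  set P := ‖y - B (κ y)‖ with hP
  set Q := ‖innerMap a (y - xs)‖ with hQ
  have hn : ‖y - B (κ y + d')‖ ≤ (1 + β * α) * P + β * Q := by
    have h1 : ‖B d'‖ ≤ ‖B‖ * (θ * ‖innerMap a (B (κ xs - κ y))‖) :=
      (B.le_opNorm d').trans (by gcongr; exact hd'n)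
    have h2 : ‖innerMap a (B (κ xs - κ y))‖ ≤ α * P + Q := by
      have e : B (κ xs - κ y) = (y - B (κ y)) - (y - xs) := by rw [map_sub, hxsB]; abel
      rw [e, map_sub]
      exact (norm_sub_le _ _).trans (by gcongr; exact (innerMap a).le_opNorm _)
    have e : y - B (κ y + d') = (y - B (κ y)) - B d' := by rw [map_add]; abel
    calc ‖y - B (κ y + d')‖ ≤ P + ‖B d'‖ := by rw [e]; exact norm_sub_le _ _
      _ ≤ P + ‖B‖ * (θ * (α * P + Q)) := by
          gcongr; exact h1.trans (by gcongr)
      _ = _ := by rw [hβ]; ring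
  have hQ2 : Q ^ 2 ≤ Δ / c := by rw [le_div_iff₀ hc]; linarith
  calc ‖y - B (κ y + d')‖ ^ 2 ≤ ((1 + β * α) * P + β * Q) ^ 2 := by gcongr
    _ ≤ 2 * (1 + β * α) ^ 2 * P ^ 2 + 2 * β ^ 2 * Q ^ 2 := by
        nlinarith [sq_nonneg ((1 + β * α) * P - β * Q)]
    _ ≤ 2 * (1 + β * α) ^ 2 * (C₁ * Δ) + 2 * β ^ 2 * (Δ / c) := by gcongr
    _ = _ := by ring

end Growth

/-! ### Block coordinate descent -/

theorem IsCyclicRule.isEssentiallyCyclicRule {K : ℕ} {s : ℕ → Fin K} (hs : IsCyclicRule s) :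
    IsEssentiallyCyclicRule s := by
  refine ⟨K, le_rfl, fun r k => ?_⟩
  have hK : 0 < K := k.pos
  refine ⟨r + (k + (K - r % K)) % K, Nat.le_add_right _ _,
    Nat.add_lt_add_left (Nat.mod_lt _ hK) _, Fin.ext ?_⟩
  have h1 := Nat.div_add_mod r K
  have h2 := Nat.mod_lt r hK
  have h3 : r + (k + (K - r % K)) = k + K * (r / K + 1) := by rw [mul_add]; omega
  rw [hs, Nat.add_mod_mod, h3, Nat.add_mul_mod_self_left, Nat.mod_eq_of_lt k.2]

/-- If an index of `[r, r + N)` satisfies `P`, there is a last one. -/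
theorem exists_last_index {P : ℕ → Prop} {r N : ℕ} (h : ∃ t, r ≤ t ∧ t < r + N ∧ P t) :
    ∃ t, r ≤ t ∧ t < r + N ∧ P t ∧ ∀ t', t < t' → t' < r + N → ¬P t' := by
  classical
  obtain ⟨t₀, h0, h1, h2⟩ := h
  obtain ⟨t, ht, hmax⟩ := exists_max_image ((Finset.Ico r (r + N)).filter P) id
    ⟨t₀, by simp [h0, h1, h2]⟩
  simp only [mem_filter, Finset.mem_Ico, id] at ht hmax
  refine ⟨t, ht.1.1, ht.1.2, ht.2, fun t' hlt hlt' hP => ?_⟩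
  have := hmax t' ⟨⟨by omega, hlt'⟩, hP⟩
  omega

section BCD

variable {m n p K : ℕ} {blk : Fin n → Fin K} {φ φ' : Fin m → ℝ → ℝ}
  {a : Fin m → EuclideanSpace ℝ (Fin n)} {g : Fin n → Fin p} {w : Fin p → ℝ}
  {xs : EuclideanSpace ℝ (Fin n)}

/-- The penalty is separable over the blocks when every group lies in one block. -/
theorem sum_groupPenalty_blockPart (hg : ∀ i j, g i = g j → blk i = blk j)
    (x : EuclideanSpace ℝ (Fin n)) :
    ∑ s, groupPenalty g w (blockPart blk s x) = groupPenalty g w x := by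
  simp only [groupPenalty]
  rw [sum_comm]
  refine sum_congr rfl fun J _ => ?_
  rw [← mul_sum]
  congr 1
  by_cases hJ : ∃ i, g i = J
  · obtain ⟨i₀, rfl⟩ := hJ
    rw [sum_eq_single (blk i₀)]
    · congr 1
      ext i
      simp [subvector_apply, blockPart_apply, hg i.1 i₀ i.2]
    · intro s _ hs
      rw [norm_eq_zero]
      ext i
      simp [subvector_apply, blockPart_apply, hg i.1 i₀ i.2, hs.symm]
    · simp
  · push Not at hJ
    have : ∀ y : EuclideanSpace ℝ (Fin n), subvector g J y = 0 := fun y => by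
      ext i; exact (hJ i.1 i.2).elim
    simp [this]

theorem IsBlockUpdate.first_order (h : IsRegularLoss φ φ') (hw : ∀ J, 0 ≤ w J) {s : Fin K}
    {x y : EuclideanSpace ℝ (Fin n)}
    (hu : IsBlockUpdate blk (fun x => separableLoss φ a x + groupPenalty g w x) s x y)
    {z : EuclideanSpace ℝ (Fin n)} (hz : ∀ i, blk i ≠ s → z i = y i) :
    0 ≤ groupPenalty g w z - groupPenalty g w y + separableLossDeriv φ' a y (z - y) :=
  h.first_order (convexOn_groupPenalty g hw) fun t =>
    hu.2 _ fun i hi => by simp [hz i hi, hu.1 i hi]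

theorem exists_norm_le_innerMap_of_block
    (hinj : ∀ s d, (∀ i, blk i ≠ s → d i = 0) → innerMap a d = 0 → d = 0) :
    ∃ θ, 0 < θ ∧ ∀ s d, (∀ i, blk i ≠ s → d i = 0) → ‖d‖ ≤ θ * ‖innerMap a d‖ := by
  have hcl : IsClosed (⋃ s, {d : EuclideanSpace ℝ (Fin n) | ∀ i, blk i ≠ s → d i = 0}) := by
    refine isClosed_iUnion_of_finite fun s => ?_
    simp only [Set.ofPred_forall]
    exact isClosed_iInter fun i => isClosed_iInter fun _ => isClosed_eq (by fun_prop) (by fun_prop)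
  obtain ⟨θ, hθ0, hθ⟩ := exists_norm_le_mul_norm_of_closed_cone (innerMap a) _ hcl
    (fun k hk t _ => by
      obtain ⟨s, hs⟩ := Set.mem_iUnion.1 hk
      exact Set.mem_iUnion.2 ⟨s, fun i hi => by simp [hs i hi]⟩)
    (fun k hk => by
      obtain ⟨s, hs⟩ := Set.mem_iUnion.1 hk
      exact hinj s k hs)
  refine ⟨θ + 1, by positivity, fun s d hd => ?_⟩
  have := hθ d (Set.mem_iUnion.2 ⟨s, hd⟩)
  nlinarith [norm_nonneg (innerMap a d)]

/-- Sufficient decrease of a block update on sublevel sets. -/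
theorem exists_sufficient_decrease (h : IsRegularLoss φ φ') (hw : ∀ J, 0 ≤ w J)
    (hinj : ∀ s d, (∀ i, blk i ≠ s → d i = 0) → innerMap a d = 0 → d = 0)
    (hxs : xs ∈ optimalSet fun x => separableLoss φ a x + groupPenalty g w x) (M : ℝ) :
    ∃ c, 0 < c ∧ ∀ s x y, separableLoss φ a x + groupPenalty g w x ≤
        separableLoss φ a xs + groupPenalty g w xs + M →
      IsBlockUpdate blk (fun x => separableLoss φ a x + groupPenalty g w x) s x y →
      c * ‖x - y‖ ^ 2 ≤ (separableLoss φ a x + groupPenalty g w x) -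
        (separableLoss φ a y + groupPenalty g w y) := by
  obtain ⟨θ, hθ0, hθ⟩ := exists_norm_le_innerMap_of_block hinj
  obtain ⟨R, hR⟩ := exists_abs_inner_le_of_sublevel h hw hxs M
  obtain ⟨c, hc, hs⟩ := h.strong R
  refine ⟨c / θ ^ 2, by positivity, fun s x y hx hu => ?_⟩
  have hyx := hu.2 x fun _ _ => rfl
  have h1 := hR x hx
  have h2 := hR y (hyx.trans hx)
  have h3 := hu.first_order h hw (z := x) fun i hi => (hu.1 i hi).symm
  have h4 : c * ‖innerMap a (x - y)‖ ^ 2 ≤ separableLoss φ a x - separableLoss φ a y -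
      separableLossDeriv φ' a y (x - y) := by
    rw [norm_sq_innerMap, mul_sum, bregman_separableLoss]
    refine sum_le_sum fun i _ => ?_
    rw [inner_sub_right]
    exact hs i _ _ (h1 i) (h2 i)
  have h5 := hθ s (x - y) fun i hi => by simp [hu.1 i hi]
  have h6 : c / θ ^ 2 * ‖x - y‖ ^ 2 ≤ c * ‖innerMap a (x - y)‖ ^ 2 := by
    calc _ ≤ c / θ ^ 2 * (θ * ‖innerMap a (x - y)‖) ^ 2 := by gcongr
      _ = _ := by field_simp
  linarith

theorem existsUnique_isBlockUpdate (h : IsRegularLoss φ φ') (hw : ∀ J, 0 ≤ w J)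
    (hinj : ∀ s d, (∀ i, blk i ≠ s → d i = 0) → innerMap a d = 0 → d = 0)
    (hxs : xs ∈ optimalSet fun x => separableLoss φ a x + groupPenalty g w x)
    (s : Fin K) (x : EuclideanSpace ℝ (Fin n)) :
    ∃! y, IsBlockUpdate blk (fun x => separableLoss φ a x + groupPenalty g w x) s x y := by
  set F := fun x => separableLoss φ a x + groupPenalty g w x with hF
  have hcont : Continuous F := h.continuous_separableLoss.add (continuous_groupPenalty g w)
  have hcl : IsClosed {z : EuclideanSpace ℝ (Fin n) | ∀ i, blk i ≠ s → z i = x i} := by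
    simp only [Set.ofPred_forall]
    exact isClosed_iInter fun i => isClosed_iInter fun _ => isClosed_eq (by fun_prop) (by fun_prop)
  refine existsUnique_of_exists_of_unique ?_ ?_
  · have hbdd : Bornology.IsBounded
        {z ∈ {z : EuclideanSpace ℝ (Fin n) | ∀ i, blk i ≠ s → z i = x i} | F z ≤ F x} := by
      obtain ⟨θ, hθ0, hθ⟩ := exists_norm_le_innerMap_of_block hinj
      obtain ⟨R, hR⟩ := exists_abs_inner_le_of_sublevel h hw hxs (F x - F xs)
      refine (Metric.isBounded_closedBall (x := x)
        (r := θ * √(∑ _i : Fin m, (2 * R) ^ 2))).subset ?_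
      rintro z ⟨hz, hzF⟩
      rw [Metric.mem_closedBall, dist_eq_norm]
      refine (hθ s (z - x) fun i hi => by simp [hz i hi]).trans ?_
      refine mul_le_mul_of_nonneg_left (Real.le_sqrt_of_sq_le ?_) hθ0.le
      rw [norm_sq_innerMap]
      refine sum_le_sum fun i _ => sq_le_sq' ?_ ?_ <;>
      · have h1 := abs_le.1 (hR z (by simp only [hF] at hzF ⊢; linarith) i)
        have h2 := abs_le.1 (hR x (by simp only [hF]; linarith) i)
        rw [inner_sub_right]
        linarith
    obtain ⟨y, hy, hmin⟩ := exists_forall_le_of_isBounded_sublevel hcont hcl (x₀ := x)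
      (fun _ _ => rfl) hbdd
    exact ⟨y, hy, hmin⟩
  · intro y y' hy hy'
    obtain ⟨c, hc, hdec⟩ := exists_sufficient_decrease h hw hinj hxs (F y' - F xs)
    have hu : IsBlockUpdate blk F s y' y :=
      ⟨fun i hi => (hy.1 i hi).trans (hy'.1 i hi).symm,
        fun z hz => hy.2 z fun i hi => (hz i hi).trans (hy'.1 i hi)⟩
    have h1 := hdec s y' y (by simp only [hF]; linarith) hu
    have h2 : F y' ≤ F y := hy'.2 y hy.1
    have h3 : ‖y' - y‖ ^ 2 ≤ 0 := by
      simp only [hF] at h2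
      by_contra! hpos
      have := mul_pos hc hpos
      linarith
    have h4 : ‖y' - y‖ = 0 := by
      rw [← sq_eq_zero_iff]; exact le_antisymm h3 (sq_nonneg _)
    exact (sub_eq_zero.1 (norm_eq_zero.1 h4)).symm

/-- The cost-to-go estimate. Suppose each block of `y` agrees with that block of a point `u s`
which is optimal with respect to the block `s`. Then the vector of gradient differences between `y`
and the `u s` is a subgradient of the objective at `y`, so that the objective at `y` exceeds its
value at any `z` by at most a constant times `(∑ s, ‖y - u s‖) ‖y - z‖`. -/
theorem exists_cost_to_go (h : IsRegularLoss φ φ') (hg : ∀ i j, g i = g j → blk i = blk j) :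
    ∃ L, 0 ≤ L ∧ ∀ (y z : EuclideanSpace ℝ (Fin n)) (u : Fin K → EuclideanSpace ℝ (Fin n)),
      (∀ s i, blk i = s → u s i = y i) →
      (∀ s ζ, (∀ i, blk i ≠ s → ζ i = u s i) →
        0 ≤ groupPenalty g w ζ - groupPenalty g w (u s) +
          separableLossDeriv φ' a (u s) (ζ - u s)) →
      (separableLoss φ a y + groupPenalty g w y) - (separableLoss φ a z + groupPenalty g w z) ≤
        L * (∑ s, ‖y - u s‖) * ‖y - z‖ := by
  obtain ⟨L, hL0, hL⟩ := h.exists_abs_deriv_sub_le a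
  refine ⟨L, hL0, fun y z u hu hfo => ?_⟩
  have h1 := h.deriv_le_sub (a := a) z y
  rw [← sum_blockPart blk (z - y), separableLossDeriv_sum] at h1
  have hpen : ∀ s, groupPenalty g w (u s + blockPart blk s (z - y)) - groupPenalty g w (u s) =
      groupPenalty g w (blockPart blk s z) - groupPenalty g w (blockPart blk s y) := by
    intro s
    rw [← sum_groupPenalty_blockPart hg (u s + blockPart blk s (z - y)),
      ← sum_groupPenalty_blockPart hg (u s), ← sum_sub_distrib, sum_eq_single s]
    · congr 2
      · ext i
        simp only [blockPart_apply, PiLp.add_apply, PiLp.sub_apply]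
        split_ifs with hi
        · rw [hu s i hi]; ring
        · rfl
      · ext i
        simp only [blockPart_apply]
        split_ifs with hi
        · rw [hu s i hi]
        · rfl
    · intro s' _ hs'
      have : blockPart blk s' (u s + blockPart blk s (z - y)) = blockPart blk s' (u s) := by
        ext i
        simp only [blockPart_apply, PiLp.add_apply]
        split_ifs with h1 h2
        · exact (hs' (h1.symm.trans h2)).elim
        · simp
        · rfl
      rw [this, sub_self]
    · simp
  have h2 : ∀ s, 0 ≤ groupPenalty g w (blockPart blk s z) - groupPenalty g w (blockPart blk s y) +
      separableLossDeriv φ' a (u s) (blockPart blk s (z - y)) := by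
    intro s
    have := hfo s (u s + blockPart blk s (z - y)) fun i hi => by simp [blockPart_apply, hi]
    rwa [hpen, add_sub_cancel_left] at this
  have h3 : ∀ s, separableLossDeriv φ' a (u s) (blockPart blk s (z - y)) -
      separableLossDeriv φ' a y (blockPart blk s (z - y)) ≤ L * ‖y - u s‖ * ‖y - z‖ := by
    intro s
    refine (le_abs_self _).trans ((hL _ _ _).trans ?_)
    rw [← mul_assoc, norm_sub_rev (u s) y, norm_sub_rev y z]
    have := norm_blockPart_le blk s (z - y)
    gcongr
  have h4 := sum_nonneg fun s (_ : s ∈ univ) => h2 s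
  have h5 := sum_le_sum fun s (_ : s ∈ univ) => h3 s
  rw [sum_add_distrib, sum_sub_distrib, sum_groupPenalty_blockPart hg,
    sum_groupPenalty_blockPart hg] at h4
  rw [sum_sub_distrib, ← sum_mul, ← mul_sum] at h5
  linarith

/-- After each window of `N` steps in which every block has been updated, the suboptimality is at
most a constant times the squared length of the path travelled in the window. -/
theorem exists_suboptimality_le_path_sq (h : IsRegularLoss φ φ') (hw : ∀ J, 0 ≤ w J)
    (hg : ∀ i j, g i = g j → blk i = blk j)
    (hxs : xs ∈ optimalSet fun x => separableLoss φ a x + groupPenalty g w x) (M : ℝ) :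
    ∃ C, 0 ≤ C ∧ ∀ (s : ℕ → Fin K) (x : ℕ → EuclideanSpace ℝ (Fin n)) (N r : ℕ),
      (∀ k, ∃ t, r ≤ t ∧ t < r + N ∧ s t = k) →
      IsBCDSequence blk (fun x => separableLoss φ a x + groupPenalty g w x) s x →
      separableLoss φ a (x (r + N)) + groupPenalty g w (x (r + N)) ≤
        separableLoss φ a xs + groupPenalty g w xs + M →
      separableLoss φ a (x (r + N)) + groupPenalty g w (x (r + N)) -
          (separableLoss φ a xs + groupPenalty g w xs) ≤
        C * (∑ t ∈ Finset.Ico r (r + N), ‖x t - x (t + 1)‖) ^ 2 := by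
  obtain ⟨L, hL0, hL⟩ := exists_cost_to_go (w := w) (a := a) h hg
  obtain ⟨C, hC0, hC⟩ := exists_quadratic_growth h hw hxs M
  refine ⟨(L * K) ^ 2 * C, by positivity, fun s x N r hwin hx hM => ?_⟩
  obtain ⟨z, hz, hyz⟩ := hC _ hM
  have hzxs := hz xs
  set F := fun x => separableLoss φ a x + groupPenalty g w x with hF
  change F (x (r + N)) - F xs ≤ _
  change ‖x (r + N) - z‖ ^ 2 ≤ C * (F (x (r + N)) - F xs) at hyz
  have he0 : 0 ≤ F (x (r + N)) - F xs := sub_nonneg.2 (hxs _)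
  set e := F (x (r + N)) - F xs with he
  set S := ∑ t ∈ Finset.Ico r (r + N), ‖x t - x (t + 1)‖ with hS
  -- `x (t k + 1)` is the iterate just after the last update of block `k` in the window
  choose t ht0 ht1 hts htlast using fun k => exists_last_index (P := fun t => s t = k) (hwin k)
  have hkeep : ∀ k i, blk i = k → ∀ j, t k + 1 + j ≤ r + N → x (t k + 1 + j) i = x (t k + 1) i := by
    intro k i hi j
    induction j with
    | zero => simp
    | succ j ih =>
      intro hj
      rw [← ih (by omega)]
      exact (hx (t k + 1 + j)).1 i fun hb =>
        htlast k (t k + 1 + j) (by omega) (by omega) (hb.symm.trans hi)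
  have h1 := hL (x (r + N)) z (fun k => x (t k + 1))
    (fun k i hi => by
      have h2 := hkeep k i hi (r + N - (t k + 1)) (by have := ht1 k; omega)
      rw [Nat.add_sub_cancel' (ht1 k)] at h2
      exact h2.symm)
    (fun k ζ hζ => (hx (t k)).first_order h hw (by rw [hts k]; exact hζ))
  have h2 : ∑ k, ‖x (r + N) - x (t k + 1)‖ ≤ K * S := by
    calc _ ≤ ∑ _k : Fin K, S := sum_le_sum fun k _ => by
            rw [← dist_eq_norm, dist_comm]
            refine (dist_le_Ico_sum_dist x (ht1 k)).trans ?_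
            simp only [dist_eq_norm]
            exact sum_le_sum_of_subset_of_nonneg
              (Finset.Ico_subset_Ico ((ht0 k).trans (Nat.le_succ _)) le_rfl)
              fun _ _ _ => norm_nonneg _
      _ = K * S := by simp
  have h3 : e ≤ L * (K * S) * ‖x (r + N) - z‖ := by
    have h4 : e ≤ L * (∑ k, ‖x (r + N) - x (t k + 1)‖) * ‖x (r + N) - z‖ := by
      simp only [he, hF] at hzxs ⊢
      linarith
    refine h4.trans ?_
    gcongr
  rcases he0.eq_or_lt with h0 | hpos
  · rw [← h0]; positivity
  · have h4 : e ^ 2 ≤ (L * (K * S)) ^ 2 * (C * e) := by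
      calc e ^ 2 ≤ (L * (K * S) * ‖x (r + N) - z‖) ^ 2 := by gcongr
        _ = (L * (K * S)) ^ 2 * ‖x (r + N) - z‖ ^ 2 := by ring
        _ ≤ _ := by gcongr
    have h5 : e * e ≤ ((L * K) ^ 2 * C * S ^ 2) * e := by nlinarith
    exact le_of_mul_le_mul_right h5 hpos

/-- Linear convergence of block coordinate descent for a regular separable loss, injective on each
block, plus a block-separable group penalty, when a minimizer exists. -/
theorem bcdConvergesRLinearly_of_isRegularLoss (h : IsRegularLoss φ φ') (hw : ∀ J, 0 ≤ w J)
    (hg : ∀ i j, g i = g j → blk i = blk j)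
    (hinj : ∀ s d, (∀ i, blk i ≠ s → d i = 0) → innerMap a d = 0 → d = 0)
    (hne : (optimalSet fun x => separableLoss φ a x + groupPenalty g w x).Nonempty) :
    BCDConvergesRLinearly blk fun x => separableLoss φ a x + groupPenalty g w x := by
  obtain ⟨xs, hxs⟩ := hne
  intro s hs x₀
  have hupd := existsUnique_isBlockUpdate h hw hinj hxs
  choose upd hupd1 hupd2 using hupd
  refine ⟨⟨fun r => Nat.rec x₀ (fun r x => upd (s r) x) r, ⟨rfl, fun r => hupd1 _ _⟩, ?_⟩, ?_⟩
  · rintro x ⟨hx0, hx⟩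
    funext r
    induction r with
    | zero => exact hx0
    | succ r ih =>
      have := hupd2 _ _ _ (hx r)
      rw [this, ih]
  intro x hx0 hx
  obtain ⟨N, hKN, hN⟩ := hs.elim IsCyclicRule.isEssentiallyCyclicRule id
  have hNpos : 0 < N := (s 0).pos.trans_le hKN
  set F := fun x => separableLoss φ a x + groupPenalty g w x with hF
  have hcont : Continuous F := h.continuous_separableLoss.add (continuous_groupPenalty g w)
  obtain ⟨c, hc, hdec⟩ := exists_sufficient_decrease h hw hinj hxs (F x₀ - F xs)
  obtain ⟨C, hC0, hC⟩ := exists_suboptimality_le_path_sq h hw hg hxs (F x₀ - F xs)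
  have hanti : Antitone fun r => F (x r) :=
    antitone_nat_of_succ_le fun r => (hx r).2 _ fun _ _ => rfl
  have hlev : ∀ r, F (x r) ≤ F xs + (F x₀ - F xs) := fun r => by
    have := hanti (Nat.zero_le r)
    simp only [hx0] at this
    linarith
  have hstep : ∀ r, c * ‖x r - x (r + 1)‖ ^ 2 ≤ F (x r) - F (x (r + 1)) :=
    fun r => hdec _ _ _ (hlev r) (hx r)
  have hwindow : ∀ r, F (x (r + N)) - F xs ≤ C * N / c * (F (x r) - F (x (r + N))) := by
    intro r
    refine (hC s x N r (hN r) hx (hlev _)).trans ?_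
    have h1 : (∑ t ∈ Finset.Ico r (r + N), ‖x t - x (t + 1)‖) ^ 2 ≤
        N * ∑ t ∈ Finset.Ico r (r + N), ‖x t - x (t + 1)‖ ^ 2 := by
      simpa using sq_sum_le_card_mul_sum_sq (s := Finset.Ico r (r + N))
        (f := fun t => ‖x t - x (t + 1)‖)
    have h2 : c * ∑ t ∈ Finset.Ico r (r + N), ‖x t - x (t + 1)‖ ^ 2 ≤ F (x r) - F (x (r + N)) := by
      rw [mul_sum]
      refine (sum_le_sum fun t _ => hstep t).trans (le_of_eq ?_)
      rw [sum_Ico_eq_sum_range, Nat.add_sub_cancel_left]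
      exact sum_range_sub' (fun j => F (x (r + j))) N
    calc _ ≤ C * (N * ∑ t ∈ Finset.Ico r (r + N), ‖x t - x (t + 1)‖ ^ 2) := by gcongr
      _ = C * N / c * (c * ∑ t ∈ Finset.Ico r (r + N), ‖x t - x (t + 1)‖ ^ 2) := by field_simp
      _ ≤ _ := by gcongr
  -- a positive constant keeps the contraction factor `D / (1 + D)` in `(0, 1)`
  set D := C * N / c + 1 with hD
  have hDpos : 0 < D := by positivity
  obtain ⟨G, q, hG0, hq0, hq1, hGq⟩ := exists_geometric_bound (e := fun r => F (x r) - F xs)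
    (ρ := D / (1 + D)) hNpos (fun i j hij => sub_le_sub_right (hanti hij) _)
    (fun r => sub_nonneg.2 (hxs _)) (by positivity) (by rw [div_lt_one (by positivity)]; linarith)
    (fun r => by
      have h1 := hwindow r
      have h2 : F (x (r + N)) ≤ F (x r) := hanti (Nat.le_add_right r N)
      have h3 : F (x (r + N)) - F xs ≤ D * (F (x r) - F (x (r + N))) := by
        rw [hD, add_mul]; linarith
      rw [div_mul_eq_mul_div, le_div_iff₀ (by positivity)]
      linarith)
  have hdist : ∀ r, dist (x r) (x (r + 1)) ≤ √(G / c) * √q ^ r := by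
    intro r
    rw [dist_eq_norm]
    refine le_of_sq_le_sq ?_ (by positivity)
    rw [mul_pow, Real.sq_sqrt (by positivity), ← pow_mul, mul_comm r 2, pow_mul,
      Real.sq_sqrt hq0.le, div_mul_eq_mul_div, le_div_iff₀ hc, mul_comm]
    refine (hstep r).trans (le_trans ?_ (hGq r))
    have := hxs (x (r + 1))
    linarith
  have hsq1 : √q < 1 := by rw [Real.sqrt_lt' one_pos]; simpa using hq1
  obtain ⟨l, hl⟩ := cauchySeq_tendsto_of_complete (cauchySeq_of_le_geometric _ _ hsq1 hdist)
  refine ⟨l, ?_, √(G / c) / (1 - √q), √q, Real.sqrt_pos.2 hq0, hsq1, fun r => ?_⟩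
  · have h1 : Tendsto (fun r => F (x r) - F xs) atTop (𝓝 (F l - F xs)) :=
      ((hcont.tendsto l).comp hl).sub_const _
    have h2 : Tendsto (fun r => G * q ^ r) atTop (𝓝 (G * 0)) :=
      (tendsto_pow_atTop_nhds_zero_of_lt_one hq0.le hq1).const_mul G
    have h3 := le_of_tendsto_of_tendsto' h1 h2 hGq
    rw [mul_zero] at h3
    intro y
    have := hxs y
    linarith
  · rw [← dist_eq_norm]
    refine (dist_le_of_le_geometric_of_tendsto _ _ hsq1 hdist hl r).trans (le_of_eq ?_)
    ring

end BCD

/-! ### Logistic and least squares losses -/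

section Logistic

/-- A function whose derivative increases at rate at least `2 c` on an interval satisfies there the
tangent inequality with the quadratic gain `c (s - t) ^ 2`. -/
theorem mul_sq_le_bregman_of_hasDerivAt {f f' f'' : ℝ → ℝ} {R c : ℝ}
    (hf : ∀ t, HasDerivAt f (f' t) t) (hf' : ∀ t, HasDerivAt f' (f'' t) t)
    (hc : ∀ t, |t| ≤ R → 2 * c ≤ f'' t) {s t : ℝ} (hs : |s| ≤ R) (ht : |t| ≤ R) :
    c * (s - t) ^ 2 ≤ f s - f t - f' t * (s - t) := by
  have hd : ∀ u, HasDerivAt (fun u => f u - c * u ^ 2) (f' u - c * (2 * u)) u := fun u => by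
    convert! (hf u).sub ((hasDerivAt_pow 2 u).const_mul c) using 1
    simp
  have hd' : ∀ u, HasDerivAt (fun u => f' u - c * (2 * u)) (f'' u - c * 2) u := fun u => by
    convert! (hf' u).sub (((hasDerivAt_id u).const_mul 2).const_mul c) using 1
    simp
  have hmono : MonotoneOn (fun u => f' u - c * (2 * u)) (Set.Icc (-R) R) := by
    refine monotoneOn_of_deriv_nonneg (convex_Icc _ _)
      (fun u _ => (hd' u).continuousAt.continuousWithinAt)
      (fun u _ => (hd' u).differentiableAt.differentiableWithinAt) fun u hu => ?_
    rw [(hd' u).deriv]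
    rw [interior_Icc] at hu
    have := hc u (abs_le.2 ⟨hu.1.le, hu.2.le⟩)
    linarith
  have hconv : ConvexOn ℝ (Set.Icc (-R) R) fun u => f u - c * u ^ 2 := by
    refine MonotoneOn.convexOn_of_deriv (convex_Icc _ _)
      (fun u _ => (hd u).continuousAt.continuousWithinAt)
      (fun u _ => (hd u).differentiableAt.differentiableWithinAt) ?_
    have : deriv (fun u => f u - c * u ^ 2) = fun u => f' u - c * (2 * u) :=
      funext fun u => (hd u).deriv
    rw [this]
    exact hmono.mono interior_subset
  have hs' := abs_le.1 hs
  have ht' := abs_le.1 ht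
  have key : (f' t - c * (2 * t)) * (s - t) ≤ (f s - c * s ^ 2) - (f t - c * t ^ 2) := by
    rcases lt_trichotomy s t with hlt | rfl | hlt
    · have := hconv.slope_le_deriv hs' ht' hlt (hd t).differentiableAt
      rw [(hd t).deriv, slope_def_field, div_le_iff₀ (sub_pos.2 hlt)] at this
      linarith
    · simp
    · have := hconv.deriv_le_slope ht' hs' hlt (hd t).differentiableAt
      rw [(hd t).deriv, slope_def_field, le_div_iff₀ (sub_pos.2 hlt)] at this
      linarith
  linarith [key, show c * (s - t) ^ 2 =
    c * s ^ 2 - c * t ^ 2 - c * (2 * t) * (s - t) by ring]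

theorem hasDerivAt_log_one_add_exp (t : ℝ) :
    HasDerivAt (fun t => Real.log (1 + Real.exp t)) (Real.sigmoid t) t := by
  convert! ((Real.hasDerivAt_exp t).const_add 1).log (by positivity) using 1
  rw [Real.sigmoid_def, Real.exp_neg]
  field_simp
  ring

theorem isRegularLoss_logistic {m : ℕ} {b : Fin m → ℝ} (hb : ∀ i, b i = 0 ∨ b i = 1) :
    IsRegularLoss (fun i t => Real.log (1 + Real.exp t) - b i * t)
      (fun i t => Real.sigmoid t - b i) where
  nonneg i t := by
    rcases hb i with h | h <;> rw [h]
    · have := Real.log_nonneg (x := 1 + Real.exp t) (by linarith [Real.exp_pos t])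
      linarith
    · have := Real.log_le_log (Real.exp_pos t) (show Real.exp t ≤ 1 + Real.exp t by linarith)
      rw [Real.log_exp] at this
      linarith
  continuous i := by
    refine Continuous.sub (Continuous.log (by fun_prop) fun t => ?_) (by fun_prop)
    positivity
  lipschitz := by
    refine ⟨1, zero_le_one, fun i s t => ?_⟩
    have := convex_univ.norm_image_sub_le_of_norm_hasDerivWithin_le (C := 1) (x := t) (y := s)
      (f := Real.sigmoid) (fun x _ => (Real.hasDerivAt_sigmoid x).hasDerivWithinAt)
      (fun x _ => by
        have h1 := Real.sigmoid_nonneg x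
        have h2 := Real.sigmoid_le_one x
        rw [Real.norm_of_nonneg (mul_nonneg h1 (sub_nonneg.2 h2))]
        nlinarith) (Set.mem_univ _) (Set.mem_univ _)
    simpa using this
  strong R := by
    refine ⟨Real.sigmoid (-R) * (1 - Real.sigmoid R) / 2, ?_, fun i s t hs ht => ?_⟩
    · have h1 := Real.sigmoid_pos (-R)
      have h2 := sub_pos.2 (Real.sigmoid_lt_one R)
      positivity
    · have := mul_sq_le_bregman_of_hasDerivAt (c := Real.sigmoid (-R) * (1 - Real.sigmoid R) / 2)
        hasDerivAt_log_one_add_exp Real.hasDerivAt_sigmoid (fun u hu => by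
          have h1 := Real.sigmoid_le (abs_le.1 hu).1
          have h2 := Real.sigmoid_le (abs_le.1 hu).2
          have h3 := Real.sigmoid_nonneg u
          have h4 := Real.sigmoid_le_one R
          rw [mul_div_cancel₀ _ two_ne_zero]
          exact mul_le_mul h1 (by linarith) (by linarith) h3) hs ht
      linarith

theorem logisticLoss_eq_separableLoss {m n : ℕ} (a : Fin m → EuclideanSpace ℝ (Fin n))
    (b : Fin m → ℝ) :
    logisticLoss a b = separableLoss (fun i t => Real.log (1 + Real.exp t) - b i * t) a := rfl

end Logistic

section LeastSquares

theorem isRegularLoss_leastSquares {m : ℕ} (b : Fin m → ℝ) :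
    IsRegularLoss (fun i t => 1 / 2 * (t - b i) ^ 2) (fun i t => t - b i) where
  nonneg i t := by positivity
  continuous i := by fun_prop
  lipschitz := ⟨1, zero_le_one, fun i s t => by simp⟩
  strong R := ⟨1 / 2, by norm_num, fun i s t _ _ => le_of_eq (by ring)⟩

variable {m n : ℕ} (A : Matrix (Fin m) (Fin n) ℝ) (b : EuclideanSpace ℝ (Fin m))

theorem innerMap_rows (x : EuclideanSpace ℝ (Fin n)) :
    innerMap (fun i => WithLp.toLp 2 (A i)) x = WithLp.toLp 2 (A.mulVec x.ofLp) := by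
  ext i
  simp [innerMap_apply, PiLp.inner_apply, Matrix.mulVec, dotProduct, mul_comm]

theorem leastSquaresLoss_eq_separableLoss :
    leastSquaresLoss A b = separableLoss (fun i t => 1 / 2 * (t - b i) ^ 2)
      (fun i => WithLp.toLp 2 (A i)) := by
  funext x
  rw [leastSquaresLoss, ← innerMap_rows, EuclideanSpace.norm_sq_eq, mul_sum]
  simp [separableLoss, innerMap_apply]

end LeastSquares

/-! ### Consequences of the hypotheses and existence of minimizers -/

section Assumptions

variable {m n p K : ℕ} {blk : Fin n → Fin K}

theorem BlockStronglyConvexOn.mono {f : EuclideanSpace ℝ (Fin n) → ℝ}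
    {S T : Set (EuclideanSpace ℝ (Fin n))} (h : BlockStronglyConvexOn blk f T) (hST : S ⊆ T) :
    BlockStronglyConvexOn blk f S := by
  obtain ⟨γ, hγ, H⟩ := h
  exact ⟨γ, hγ, fun x hx s Δ hΔ hxΔ => H x (hST hx) s Δ hΔ (hST hxΔ)⟩

/-- Strong convexity along a block rules out that all `aᵢ` vanish on a direction `d` in it: the loss
would be constant along the line spanned by `d`, and the inequalities for `d` and `-d`, both
based at `0`, would add up to a contradiction. -/
theorem injective_on_blocks_of_blockStronglyConvexOn {φ : Fin m → ℝ → ℝ}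
    {a : Fin m → EuclideanSpace ℝ (Fin n)}
    (h : ∀ R, BlockStronglyConvexOn blk (separableLoss φ a) (Metric.closedBall 0 R)) :
    ∀ s d, (∀ i, blk i ≠ s → d i = 0) → innerMap a d = 0 → d = 0 := by
  intro s d hd hAd
  obtain ⟨γ, hγ, H⟩ := h ‖d‖
  have hin : ∀ i, inner ℝ (a i) d = 0 := fun i => by rw [← innerMap_apply, hAd]; rfl
  have h1 := H 0 (by simp) s d hd (by simp)
  have h2 := H 0 (by simp) s (-d) (fun i hi => by simp [hd i hi]) (by simp)
  simp only [separableLoss, zero_add, inner_neg_right, hin, neg_zero, inner_zero_right, sub_self,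
    zero_sub, norm_neg, neg_neg] at h1 h2
  have h3 : ‖d‖ ^ 2 ≤ 0 := by
    by_contra! hpos
    have := mul_pos hγ hpos
    linarith
  exact norm_eq_zero.1 (sq_eq_zero_iff.1 (le_antisymm h3 (sq_nonneg _)))

theorem mul_norm_le_groupPenalty (g : Fin n → Fin p) {w : Fin p → ℝ} {κ : ℝ} (hκ : 0 ≤ κ)
    (hw : ∀ J, κ ≤ w J) (x : EuclideanSpace ℝ (Fin n)) : κ * ‖x‖ ≤ groupPenalty g w x := by
  have h1 : ‖x‖ ≤ ∑ J, ‖subvector g J x‖ := by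
    refine le_of_sq_le_sq ?_ (sum_nonneg fun J _ => norm_nonneg _)
    rw [← sum_norm_sq_subvector g]
    exact sum_sq_le_sq_sum_of_nonneg fun J _ => norm_nonneg _
  calc κ * ‖x‖ ≤ κ * ∑ J, ‖subvector g J x‖ := by gcongr
    _ ≤ _ := by
      rw [mul_sum]
      exact sum_le_sum fun J _ => mul_le_mul_of_nonneg_right (hw J) (norm_nonneg _)

theorem optimalSet_nonempty_of_pos_weights {φ φ' : Fin m → ℝ → ℝ} (h : IsRegularLoss φ φ')
    (a : Fin m → EuclideanSpace ℝ (Fin n)) (g : Fin n → Fin p) {w : Fin p → ℝ}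
    (hw : ∀ J, 0 < w J) :
    (optimalSet fun x => separableLoss φ a x + groupPenalty g w x).Nonempty := by
  obtain ⟨κ, hκ, hκw⟩ : ∃ κ, 0 < κ ∧ ∀ J, κ ≤ w J := by
    rcases isEmpty_or_nonempty (Fin p) with he | hne
    · exact ⟨1, one_pos, fun J => he.elim J⟩
    · obtain ⟨J, hJ⟩ := Finite.exists_min w
      exact ⟨w J, hw J, hJ⟩
  obtain ⟨y, -, hy⟩ := exists_forall_le_of_isBounded_sublevel (S := Set.univ) (x₀ := 0)
    ((h.continuous_separableLoss (a := a)).add (continuous_groupPenalty g w)) isClosed_univ (Set.mem_univ _)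
    ((Metric.isBounded_closedBall (x := 0)
      (r := (separableLoss φ a 0 + groupPenalty g w 0) / κ)).subset fun x hx => by
        rw [mem_closedBall_zero_iff, le_div_iff₀ hκ, mul_comm]
        have h1 := mul_norm_le_groupPenalty g hκ.le hκw x
        have h2 := h.separableLoss_nonneg (a := a) x
        have h3 : separableLoss φ a x + groupPenalty g w x ≤
          separableLoss φ a 0 + groupPenalty g w 0 := hx.2
        linarith)
  exact ⟨y, fun z => hy z (Set.mem_univ _)⟩

/-- The group LASSO attains its minimum, even if some weights vanish: the objective is a coercive
function of `(A x, (w_J x_J)_J)`, which ranges over a subspace. -/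
theorem optimalSet_leastSquares_nonempty (A : Matrix (Fin m) (Fin n) ℝ)
    (b : EuclideanSpace ℝ (Fin m)) (g : Fin n → Fin p) {w : Fin p → ℝ} (hw : ∀ J, 0 ≤ w J) :
    (optimalSet fun x => leastSquaresLoss A b x + groupPenalty g w x).Nonempty := by
  let T : EuclideanSpace ℝ (Fin n) →ₗ[ℝ] EuclideanSpace ℝ (Fin m) × EuclideanSpace ℝ (Fin n) :=
    { toFun := fun x =>
        (innerMap (fun i => WithLp.toLp 2 (A i)) x, WithLp.toLp 2 fun i => w (g i) * x i)
      map_add' := fun x y => Prod.ext (map_add _ _ _) (by ext i; simp [mul_add])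
      map_smul' := fun t x => Prod.ext (map_smul _ _ _) (by
        ext i; simp only [PiLp.smul_apply, smul_eq_mul, RingHom.id_apply, Prod.smul_snd]; ring) }
  let G : EuclideanSpace ℝ (Fin m) × EuclideanSpace ℝ (Fin n) → ℝ :=
    fun u => 1 / 2 * ‖u.1 - b‖ ^ 2 + groupPenalty g (fun _ => 1) u.2
  have hG : Continuous G :=
    (by fun_prop : Continuous fun u : EuclideanSpace ℝ (Fin m) × EuclideanSpace ℝ (Fin n) =>
      1 / 2 * ‖u.1 - b‖ ^ 2).add ((continuous_groupPenalty g _).comp continuous_snd)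
  have hFG : ∀ x, leastSquaresLoss A b x + groupPenalty g w x = G (T x) := by
    intro x
    simp only [G, T, LinearMap.coe_mk, AddHom.coe_mk, leastSquaresLoss, innerMap_rows]
    congr 1
    refine sum_congr rfl fun J _ => ?_
    have : subvector g J (WithLp.toLp 2 fun i => w (g i) * x i) = w J • subvector g J x := by
      ext i
      simp [subvector_apply, i.2]
    rw [this, norm_smul, Real.norm_of_nonneg (hw J), one_mul]
  have hb : Bornology.IsBounded {u ∈ (LinearMap.range T : Set _) | G u ≤ G (T 0)} := by
    refine (Metric.isBounded_closedBall (x := (b, 0)) (r := 1 + 2 * G (T 0))).subset ?_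
    rintro u ⟨-, hu⟩
    have h1 := mul_norm_le_groupPenalty g zero_le_one (fun _ => le_rfl) u.2
    have h2 : 1 / 2 * ‖u.1 - b‖ ^ 2 + groupPenalty g (fun _ => 1) u.2 ≤ G (T 0) := hu
    have h3 := norm_nonneg u.2
    rw [Metric.mem_closedBall, Prod.dist_eq, dist_eq_norm, dist_zero_right]
    refine max_le ?_ ?_ <;> nlinarith [sq_nonneg (‖u.1 - b‖ - 1)]
  obtain ⟨_, ⟨y, rfl⟩, hy⟩ := exists_forall_le_of_isBounded_sublevel hG
    (LinearMap.range T).closed_of_finiteDimensional ⟨0, rfl⟩ hb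
  refine ⟨y, fun z => ?_⟩
  simp only [hFG]
  exact hy _ ⟨z, rfl⟩

theorem l1Penalty_eq_groupPenalty (lam : ℝ) :
    l1Penalty (n := n) lam = groupPenalty id fun _ => lam := by
  funext x
  rw [l1Penalty, groupPenalty, mul_sum]
  refine sum_congr rfl fun i _ => ?_
  congr 1
  rw [EuclideanSpace.norm_eq, sum_eq_single (⟨i, rfl⟩ : {j : Fin n // id j = i})
    (fun j _ hj => (hj (Subtype.ext j.2)).elim)
    (fun hi => (hi (mem_univ _)).elim)]
  simp [subvector_apply, Real.sqrt_sq_eq_abs]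

end Assumptions

theorem bcdConvergesRLinearly_groupLasso {m n p K : ℕ} {blk : Fin n → Fin K}
    (A : Matrix (Fin m) (Fin n) ℝ) (b : EuclideanSpace ℝ (Fin m)) (g : Fin n → Fin p)
    (w : Fin p → ℝ) (hw : ∀ J, 0 ≤ w J) (hg : ∀ i j, g i = g j → blk i = blk j)
    (hsc : BlockStronglyConvexOn blk (leastSquaresLoss A b) Set.univ) :
    BCDConvergesRLinearly blk (fun x => leastSquaresLoss A b x + groupPenalty g w x) := by
  have hne := optimalSet_leastSquares_nonempty A b g hw
  rw [leastSquaresLoss_eq_separableLoss] at hsc hne ⊢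
  exact bcdConvergesRLinearly_of_isRegularLoss (isRegularLoss_leastSquares b) hw hg
    (injective_on_blocks_of_blockStronglyConvexOn fun R => hsc.mono (Set.subset_univ _)) hne

end

theorem mainTheorem3 {m n p K : ℕ} (blk : Fin n → Fin K) :
    -- LASSO
    (∀ (A : Matrix (Fin m) (Fin n) ℝ) (b : EuclideanSpace ℝ (Fin m)) (lam : ℝ),
      0 ≤ lam →
      BlockStronglyConvexOn blk (leastSquaresLoss A b) Set.univ →
      BCDConvergesRLinearly blk (fun x => leastSquaresLoss A b x + l1Penalty lam x)) ∧
    -- Group LASSO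
    (∀ (A : Matrix (Fin m) (Fin n) ℝ) (b : EuclideanSpace ℝ (Fin m))
        (g : Fin n → Fin p) (w : Fin p → ℝ),
      (∀ J, 0 ≤ w J) →
      (∀ i j, g i = g j → blk i = blk j) →
      BlockStronglyConvexOn blk (leastSquaresLoss A b) Set.univ →
      BCDConvergesRLinearly blk (fun x => leastSquaresLoss A b x + groupPenalty g w x)) ∧
    -- logistic Group LASSO
    (∀ (a : Fin m → EuclideanSpace ℝ (Fin n)) (b : Fin m → ℝ)
        (g : Fin n → Fin p) (w : Fin p → ℝ),
      (∀ i, b i = 0 ∨ b i = 1) →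
      (∀ J, 0 ≤ w J) →
      (∀ i j, g i = g j → blk i = blk j) →
      ((∃ J, w J = 0) →
        (optimalSet (fun x => logisticLoss a b x + groupPenalty g w x)).Nonempty) →
      (∀ S : Set (EuclideanSpace ℝ (Fin n)), Bornology.IsBounded S →
        BlockStronglyConvexOn blk (logisticLoss a b) S) →
      BCDConvergesRLinearly blk (fun x => logisticLoss a b x + groupPenalty g w x)) := by
  refine ⟨fun A b lam hlam hsc => ?_, fun A b g w hw hg hsc => ?_,
    fun a b g w hb hw hg hne hsc => ?_⟩
  · rw [l1Penalty_eq_groupPenalty]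
    exact bcdConvergesRLinearly_groupLasso A b id _ (fun _ => hlam)
      (fun i j hij => congrArg blk hij) hsc
  · exact bcdConvergesRLinearly_groupLasso A b g w hw hg hsc
  · simp only [logisticLoss_eq_separableLoss] at hne hsc ⊢
    refine bcdConvergesRLinearly_of_isRegularLoss (isRegularLoss_logistic hb) hw hg
      (injective_on_blocks_of_blockStronglyConvexOn fun R => hsc _ Metric.isBounded_closedBall) ?_
    by_cases h0 : ∃ J, w J = 0
    · exact hne h0
    · push Not at h0
      exact optimalSet_nonempty_of_pos_weights (isRegularLoss_logistic hb) a g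
        fun J => lt_of_le_of_ne (hw J) (h0 J).symm
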